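/- Let $\mathbb U^*=\{\zeta\in\mathbb C:|\zeta|>1\}$ and let $\Sigma$ be the class of functions $f$ meromorphic in $\mathbb U^*$ (finite poles are allowed) that have near infinity an expansion $f(\zeta)=b\zeta+b_0+\frac{b_1}{\zeta}+\cdots$ with $b\neq 0$. For $f\in\Sigma$ let $S_f=\left(\frac{f''}{f'}\right)'-\frac12\left(\frac{f''}{f'}\right)^2$ be its Schwarzian derivative. A meromorphic function is called univalent in an open set if it is injective there as a map into the Riemann sphere, and locally univalent if it is univalent in some neighbourhood of each point. Let $f,g\in\Sigma$ be locally univalent in $\mathbb U^*$, let $h$ be analytic in $\mathbb U^*$ with $\operatorname{Re}h(\zeta)\ge\frac12$ and $h(\zeta)=1+\frac{h_2}{\zeta^2}+\frac{h_3}{\zeta^3}+\cdots$ for $\zeta\in\mathbb U^*$, and let $\alpha\in\mathbb C$. Suppose that $$\left|\frac{1-h(\zeta)}{h(\zeta)}|\zeta|^2-(|\zeta|^2-1)\left[\frac{\zeta h'(\zeta)}{h(\zeta)}+(1-2\alpha)\frac{\zeta f''(\zeta)}{f'(\zeta)}+2\alpha\frac{\zeta g''(\zeta)}{g'(\zeta)}\right]+\alpha(|\zeta|^2-1)^2\frac{\zeta}{\overline\zeta}\,h(\zeta)\left[\left(\alpha-\frac12\right)\left(\frac{f''(\zeta)}{f'(\zeta)}-\frac{g''(\zeta)}{g'(\zeta)}\right)^2+S_f(\zeta)-S_g(\zeta)\right]\right|\le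 1$$ for all $\zeta\in\mathbb U^*$ that are not poles of $f$ or $g$. Then $f$ is univalent in $\mathbb U^*$. -/

import Mathlib

open Set Filter Topology

noncomputable section

/-- The exterior `{ζ : |ζ| > 1}` of the closed unit disk, a subset of the finite plane. -/
def exteriorDisk : Set ℂ := {ζ : ℂ | 1 < ‖ζ‖}

open Classical in
/-- The value of a meromorphic function in the Riemann sphere: `∞` at the poles. (Mathlib's
meromorphic functions in normal form are complex valued, with a conventional value at poles, which
is ignored here.) -/
def sphereValue (f : ℂ → ℂ) (ζ : ℂ) : OnePoint ℂ :=
  if meromorphicOrderAt f ζ < 0 then OnePoint.infty else (f ζ : OnePoint ℂ)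

/-- `f` is univalent in `U`: meromorphic (each point of `U` is a pole of `f` or a point of
analyticity) and injective as a map to the Riemann sphere. -/
def UnivalentOn (f : ℂ → ℂ) (U : Set ℂ) : Prop :=
  MeromorphicNFOn f U ∧ InjOn (sphereValue f) U

/-- `f` is locally univalent in `U`: univalent in a neighbourhood of each point of `U`. -/
def LocallyUnivalentOn (f : ℂ → ℂ) (U : Set ℂ) : Prop :=
  ∀ ζ ∈ U, ∃ V : Set ℂ, IsOpen V ∧ ζ ∈ V ∧ V ⊆ U ∧ UnivalentOn f V

/-- The class `Σ`: functions meromorphic in `|ζ| > 1` with a simple pole at infinity, that is, with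
an expansion `f ζ = b ζ + b₀ + b₁ / ζ + b₂ / ζ² + ⋯`, `b ≠ 0`, near infinity. -/
def ClassSigma (f : ℂ → ℂ) : Prop :=
  MeromorphicNFOn f exteriorDisk ∧
    ∃ (b : ℂ) (c : ℕ → ℂ) (R : ℝ), b ≠ 0 ∧
      ∀ ζ : ℂ, R < ‖ζ‖ → HasSum (fun n : ℕ => c n / ζ ^ n) (f ζ - b * ζ)

/-- The quotient `f'' / f'`. -/
def preSchwarzian (f : ℂ → ℂ) (ζ : ℂ) : ℂ := deriv (deriv f) ζ / deriv f ζ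

/-- The Schwarzian derivative `(f'' / f')' - (f'' / f')² / 2`. -/
def schwarzian (f : ℂ → ℂ) (ζ : ℂ) : ℂ :=
  deriv (preSchwarzian f) ζ - 1 / 2 * preSchwarzian f ζ ^ 2

end

/-! The proof is a Loewner-type argument that follows pairs of points out to infinity. Let `b = h'/h
+ (1 - 2α) f''/f' + 2α g''/g'`, and let `c` be `α h` times the last bracket of the criterion. The
function `Φ(z, x) = f + x h f' / (1 - α x h (f''/f' - g''/g'))` equals `f` at `x = 0` and is
constant along solutions of the Riccati equation `dx/dz = -(1/h + b x + c x²)`. Prescribing `x =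
(e^{-2t} - 1) z` and writing `z = 1 / (e^{-t} ξ)` turns this equation into a Loewner equation `ξ' =
-ξ (1 - q) / (1 + q)` in the unit disc. On `|ξ| = 1` the criterion says exactly `|q| ≤ 1`, so `|q(t,
ξ)| ≤ |ξ|` by the Schwarz lemma (`norm_loewnerQuotient_le`). Hence solutions exist on every interval
`[0, T]`, decay exponentially and never meet (`exists_loewner_solution`, `loewner_solution_ne`,
combined in `exists_riccatiCurves`).

If `f` takes the same value at two distinct points, then `Φ` takes the same value at the ends of the
two curves (`riccatiLift_cross_eq`). With `s = e^{-T}` and `β` the leading coefficient of `f`, one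
has `Φ(z, (s² - 1) z) = β s² z` plus a function that is Lipschitz in `1/z`. The decay of `ξ` puts
the ends in `|1/z| < ε s`, where the linear term dominates, so the two values differ
(`exists_separation`): a contradiction.

Poles need separate care. Comparing polar parts in the criterion shows that `f` can have poles only
if `α = 1/2` and `g` only if `α = 0` (`pole_conditions`); then the offending terms of `b` and `c`
have coefficient zero or extend analytically. In the case `α = 1/2`, `f` is written as `u / v` with
`u`, `v` holomorphic and Wronskian nonvanishing. Both solve one linear second-order equation, and
`Φ` becomes a quotient of two lifts obeying the same first-order linear equation along a curve, so
that poles of `Φ` do no harm. -/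

/-! ### Lipschitz estimates for the flow. -/

/-- Radial retraction of the complex plane onto the closed disc of radius `r`. -/
noncomputable def radialRetraction (r : ℝ) (x : ℂ) : ℂ := ((r / max r ‖x‖ : ℝ) : ℂ) * x

theorem norm_radialRetraction_le {r : ℝ} (hr : 0 < r) (x : ℂ) : ‖radialRetraction r x‖ ≤ r := by
  have hM : 0 < max r ‖x‖ := lt_max_of_lt_left hr
  rw [radialRetraction, norm_mul, Complex.norm_real, Real.norm_of_nonneg (by positivity),
    div_mul_eq_mul_div, div_le_iff₀ hM]
  exact mul_le_mul_of_nonneg_left (le_max_right _ _) hr.le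

theorem radialRetraction_of_norm_le {r : ℝ} (hr : 0 < r) {x : ℂ} (hx : ‖x‖ ≤ r) :
    radialRetraction r x = x := by
  rw [radialRetraction, max_eq_left hx, div_self hr.ne']; simp

theorem lipschitzWith_radialRetraction {r : ℝ} (hr : 0 < r) :
    LipschitzWith 2 (radialRetraction r) := by
  refine LipschitzWith.of_dist_le_mul fun x y => ?_
  rw [dist_eq_norm, dist_eq_norm]
  have hx : 0 < max r ‖x‖ := lt_max_of_lt_left hr
  have hy : 0 < max r ‖y‖ := lt_max_of_lt_left hr
  -- Moving the point and changing the scaling factor each cost at most `‖x - y‖`, whence the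
  -- constant 2.
  have e : radialRetraction r x - radialRetraction r y
      = ((r / max r ‖x‖ : ℝ) : ℂ) * (x - y)
        + ((r / max r ‖x‖ - r / max r ‖y‖ : ℝ) : ℂ) * y := by
    simp only [radialRetraction]; push_cast; ring
  have h1 : r / max r ‖x‖ ≤ 1 := (div_le_one hx).2 (le_max_left _ _)
  have h2 : |r / max r ‖x‖ - r / max r ‖y‖| * ‖y‖ ≤ ‖x - y‖ := by
    have e2 : r / max r ‖x‖ - r / max r ‖y‖
        = (r / max r ‖x‖) * ((max r ‖y‖ - max r ‖x‖) / max r ‖y‖) := by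
      field_simp
    have h3 : |max r ‖y‖ - max r ‖x‖| ≤ ‖x - y‖ := by
      rw [max_comm r, max_comm r]
      exact (abs_max_sub_max_le_abs _ _ _).trans ((abs_norm_sub_norm_le _ _).trans_eq (norm_sub_rev _ _))
    rw [e2, abs_mul, abs_of_pos (div_pos hr hx), abs_div, abs_of_pos hy]
    calc r / max r ‖x‖ * (|max r ‖y‖ - max r ‖x‖| / max r ‖y‖) * ‖y‖
        = (r / max r ‖x‖) * (|max r ‖y‖ - max r ‖x‖| * (‖y‖ / max r ‖y‖)) := by ring
      _ ≤ 1 * (‖x - y‖ * 1) := by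
        gcongr
        exact (div_le_one hy).2 (le_max_right _ _)
      _ = ‖x - y‖ := by ring
  rw [e]
  refine (norm_add_le _ _).trans ?_
  rw [norm_mul, norm_mul, Complex.norm_real, Complex.norm_real, Real.norm_eq_abs,
    Real.norm_eq_abs, abs_of_pos (div_pos hr hx)]
  have := mul_le_mul_of_nonneg_right h1 (norm_nonneg (x - y))
  push_cast
  linarith

/-- A bounded holomorphic function is Lipschitz on smaller discs. -/
theorem lipschitzOnWith_closedBall_of_norm_le {f : ℂ → ℂ} {r R : ℝ} {M : NNReal} (hrR : r < R)
    (hf : DifferentiableOn ℂ f (Metric.ball 0 R)) (hM : ∀ z ∈ Metric.ball (0 : ℂ) R, ‖f z‖ ≤ M) :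
    LipschitzOnWith (M / ⟨(R - r) / 2, by linarith⟩) f (Metric.closedBall 0 r) := by
  refine Convex.lipschitzOnWith_of_nnnorm_deriv_le (𝕜 := ℂ) (fun z hz => ?_) (fun z hz => ?_)
    (convex_closedBall 0 r)
  · rw [mem_closedBall_zero_iff] at hz
    exact hf.differentiableAt (Metric.isOpen_ball.mem_nhds (by simpa using hz.trans_lt hrR))
  · rw [mem_closedBall_zero_iff] at hz
    have hsub : Metric.closedBall z ((R - r) / 2) ⊆ Metric.ball 0 R := by
      intro w hw
      rw [mem_closedBall_iff_norm] at hw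
      rw [mem_ball_zero_iff]
      have := norm_add_le (w - z) z
      rw [sub_add_cancel] at this
      linarith
    have := Complex.norm_deriv_le_of_forall_mem_sphere_norm_le (c := z) (R := (R - r) / 2) (C := M)
      (by linarith) ((hf.mono hsub).diffContOnCl_ball subset_rfl)
      (fun w hw => hM w (hsub (Metric.sphere_subset_closedBall hw)))
    exact this

/-! ### The Loewner equation in the unit disc. -/

/-- The Loewner vector field `-ξ (1 - q) / (1 + q)`. -/
noncomputable def loewnerField (q : ℝ → ℂ → ℂ) (t : ℝ) (ξ : ℂ) : ℂ :=
  -(ξ * ((1 - q t ξ) / (1 + q t ξ)))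

theorem one_add_ne_zero_of_norm_lt {w : ℂ} (h : ‖w‖ < 1) : 1 + w ≠ 0 := by
  intro h0
  have : w = -1 := by linear_combination h0
  rw [this] at h; simp at h

theorem norm_one_sub_div_one_add_le {w : ℂ} {ρ : ℝ} (hw : ‖w‖ ≤ ρ) (hρ : ρ < 1) :
    ‖(1 - w) / (1 + w)‖ ≤ 2 / (1 - ρ) := by
  rw [norm_div]
  have h1 : ‖1 - w‖ ≤ 2 := by
    refine (norm_sub_le _ _).trans ?_; rw [norm_one]; linarith
  have h2 : 1 - ρ ≤ ‖1 + w‖ := by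
    have := norm_sub_norm_le (1 : ℂ) (-w)
    rw [norm_one, norm_neg, sub_neg_eq_add] at this
    linarith
  have : 0 < 1 - ρ := by linarith
  gcongr

/-- This lower bound is the exponential decay rate of `‖ξ‖` along the Loewner flow. -/
theorem le_re_one_sub_div_one_add {w : ℂ} {ρ : ℝ} (hw : ‖w‖ ≤ ρ) (hρ : ρ < 1) :
    (1 - ρ) / (1 + ρ) ≤ ((1 - w) / (1 + w)).re := by
  have h0 : 0 ≤ ρ := (norm_nonneg w).trans hw
  have hne : 1 + w ≠ 0 := one_add_ne_zero_of_norm_lt (hw.trans_lt hρ)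
  have hpos : 0 < Complex.normSq (1 + w) := Complex.normSq_pos.2 hne
  have hn : Complex.normSq w ≤ ρ ^ 2 := by
    rw [Complex.normSq_eq_norm_sq]; gcongr
  have hre : w.re ≤ ρ := (Complex.re_le_norm w).trans hw
  rw [Complex.div_re, ← add_div, div_le_div_iff₀ (by linarith) hpos]
  simp only [Complex.normSq_apply, Complex.add_re, Complex.sub_re, Complex.one_re, Complex.add_im,
    Complex.sub_im, Complex.one_im] at *
  nlinarith [mul_nonneg h0 (sub_nonneg.2 hre), mul_nonneg h0 (sub_nonneg.2 hn), mul_nonneg (sub_nonneg.2 hρ.le) (sub_nonneg.2 hre)]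

/-- The bound on `q` controls the field on the disc of radius `(1 + r) / 2` independently of `t`,
and Cauchy's estimate turns this into one Lipschitz constant valid for all times. -/
theorem loewnerField_lipschitz {q : ℝ → ℂ → ℂ}
    (hq : ∀ t, 0 ≤ t → DifferentiableOn ℂ (q t) (Metric.ball 0 1))
    (hb : ∀ t, 0 ≤ t → ∀ ξ ∈ Metric.ball (0 : ℂ) 1, ‖q t ξ‖ ≤ ‖ξ‖) {r : ℝ} (hr : r < 1) :
    ∃ K : NNReal, ∀ t, 0 ≤ t → LipschitzOnWith K (loewnerField q t) (Metric.closedBall 0 r) := by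
  have hr2 : r < (1 + r) / 2 := by linarith
  have hr3 : (1 + r) / 2 < 1 := by linarith
  have hM : 0 ≤ 2 / (1 - (1 + r) / 2) := by
    apply div_nonneg <;> linarith
  refine ⟨_, fun t ht => lipschitzOnWith_closedBall_of_norm_le (M := ⟨_, hM⟩) hr2 ?_ ?_⟩
  · have hd := (hq t ht).mono (Metric.ball_subset_ball hr3.le)
    refine (differentiableOn_id.mul ((hd.const_sub 1).div (hd.const_add 1) fun z hz => ?_)).neg
    rw [mem_ball_zero_iff] at hz
    refine one_add_ne_zero_of_norm_lt ((hb t ht z (by simpa using hz.trans hr3)).trans_lt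
      (hz.trans hr3))
  · intro z hz
    rw [mem_ball_zero_iff] at hz
    rw [loewnerField, norm_neg, norm_mul]
    have h1 := hb t ht z (by simpa using hz.trans hr3)
    have h2 := norm_one_sub_div_one_add_le (h1.trans hz.le) hr3
    calc ‖z‖ * ‖(1 - q t z) / (1 + q t z)‖ ≤ 1 * (2 / (1 - (1 + r) / 2)) := by
          gcongr
          exact (hz.trans hr3).le
      _ = _ := one_mul _

/-- Global solutions of the Loewner equation in the unit disc, with exponential decay. -/
theorem exists_loewner_solution {q : ℝ → ℂ → ℂ}
    (hq : ∀ t, 0 ≤ t → DifferentiableOn ℂ (q t) (Metric.ball 0 1))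
    (hb : ∀ t, 0 ≤ t → ∀ ξ ∈ Metric.ball (0 : ℂ) 1, ‖q t ξ‖ ≤ ‖ξ‖)
    (hc : ∀ ξ ∈ Metric.ball (0 : ℂ) 1, ContinuousOn (fun t => q t ξ) (Ici 0))
    {r : ℝ} (hr0 : 0 < r) (hr : r < 1) {ξ₀ : ℂ} (hξ₀ : ‖ξ₀‖ ≤ r) {T : ℝ} (hT : 0 ≤ T) :
    ∃ ξ : ℝ → ℂ, ξ 0 = ξ₀ ∧
      ∀ t ∈ Icc 0 T, HasDerivWithinAt ξ (loewnerField q t (ξ t)) (Icc 0 T) t ∧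
        ‖ξ t‖ ≤ ‖ξ₀‖ * Real.exp (-((1 - r) / (1 + r)) * t) := by
  obtain ⟨K, hK⟩ := loewnerField_lipschitz hq hb hr
  -- Composed with the retraction, the field is bounded and Lipschitz on the whole plane, so
  -- Picard–Lindelöf reaches the prescribed `T` in one go. The retraction is removed once `‖ξ‖` is
  -- known to decrease.
  set Y : ℝ → ℂ → ℂ := fun t x => loewnerField q t (radialRetraction r x) with hY
  have hπ : ∀ x, radialRetraction r x ∈ Metric.closedBall (0 : ℂ) r := fun x => by
    simpa using norm_radialRetraction_le hr0 x
  have hπ1 : ∀ x, radialRetraction r x ∈ Metric.ball (0 : ℂ) 1 := fun x => by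
    simpa using (norm_radialRetraction_le hr0 x).trans_lt hr
  have hqle : ∀ t, 0 ≤ t → ∀ x, ‖q t (radialRetraction r x)‖ ≤ r := fun t ht x =>
    (hb t ht _ (hπ1 x)).trans (norm_radialRetraction_le hr0 x)
  have hL0 : 0 ≤ 2 / (1 - r) := div_nonneg zero_le_two (by linarith)
  set L : NNReal := ⟨2 / (1 - r), hL0⟩ with hL
  have hPL : IsPicardLindelof Y (tmin := 0) (tmax := T) ⟨0, le_rfl, hT⟩ ξ₀
      (L * ⟨T, hT⟩) 0 L (K * 2) := by
    refine ⟨fun t ht => ?_, fun x _ => ?_, fun t ht x _ => ?_, ?_⟩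
    · exact ((hK t ht.1).comp (lipschitzWith_radialRetraction hr0).lipschitzOnWith
        fun x _ => hπ x)
    · have := (hc _ (hπ1 x)).mono (Icc_subset_Ici_self : Icc 0 T ⊆ Ici 0)
      refine (continuousOn_const.mul ((continuousOn_const.sub this).div
        (continuousOn_const.add this) fun t ht => ?_)).neg
      exact one_add_ne_zero_of_norm_lt ((hqle t ht.1 x).trans_lt hr)
    · rw [hY]; simp only [loewnerField, norm_neg, norm_mul]
      calc _ ≤ 1 * (2 / (1 - r)) := by
            gcongr
            · exact (norm_radialRetraction_le hr0 x).trans hr.le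
            · exact norm_one_sub_div_one_add_le (hqle t ht.1 x) hr
        _ = L := by rw [one_mul, hL]; rfl
    · simp only [sub_zero, sub_self, max_eq_left hT, NNReal.coe_zero]
      exact le_rfl
  obtain ⟨ξ, h0, hξ⟩ := hPL.exists_eq_forall_mem_Icc_hasDerivWithinAt₀
  have h0' : ξ 0 = ξ₀ := h0
  -- the squared norm
  have hsq : ∀ t ∈ Icc 0 T, HasDerivWithinAt (fun s => ‖ξ s‖ ^ 2)
      (2 * inner ℝ (ξ t) (Y t (ξ t))) (Icc 0 T) t := fun t ht => (hξ t ht).norm_sq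
  have hinner : ∀ t x, inner ℝ x (Y t x) = -(r / max r ‖x‖ * ‖x‖ ^ 2 *
      ((1 - q t (radialRetraction r x)) / (1 + q t (radialRetraction r x))).re) := by
    intro t x
    rw [hY]
    simp only [loewnerField]
    generalize (1 - q t (radialRetraction r x)) / (1 + q t (radialRetraction r x)) = p
    rw [Complex.inner, radialRetraction, ← Complex.normSq_eq_norm_sq, Complex.normSq_apply]
    simp
    ring
  have hre : ∀ t, 0 ≤ t → ∀ x, (1 - r) / (1 + r) ≤
      ((1 - q t (radialRetraction r x)) / (1 + q t (radialRetraction r x))).re := fun t ht x =>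
    le_re_one_sub_div_one_add (hqle t ht x) hr
  have hκ : 0 < (1 - r) / (1 + r) := div_pos (by linarith) (by linarith)
  have hsub : interior (Icc (0:ℝ) T) ⊆ Icc 0 T := interior_subset
  have hcont : ContinuousOn ξ (Icc 0 T) := fun t ht => (hξ t ht).continuousWithinAt
  have hanti : AntitoneOn (fun s => ‖ξ s‖ ^ 2) (Icc 0 T) := by
    refine antitoneOn_of_hasDerivWithinAt_nonpos (convex_Icc 0 T) (hcont.norm.pow 2)
      (fun t ht => (hsq t (hsub ht)).mono hsub) fun t ht => ?_
    rw [hinner]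
    have h1 := hκ.le.trans (hre t (hsub ht).1 (ξ t))
    have : 0 ≤ r / max r ‖ξ t‖ := div_nonneg hr0.le (hr0.le.trans (le_max_left _ _))
    have := mul_nonneg (mul_nonneg this (sq_nonneg ‖ξ t‖)) h1
    linarith
  have hle : ∀ t ∈ Icc 0 T, ‖ξ t‖ ≤ r := by
    intro t ht
    have := hanti (left_mem_Icc.2 hT) ht ht.1
    simp only [h0'] at this
    exact (pow_le_pow_iff_left₀ (norm_nonneg _) (norm_nonneg _) two_ne_zero).1 this |>.trans hξ₀
  refine ⟨ξ, h0', fun t ht => ⟨?_, ?_⟩⟩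
  · have := hξ t ht
    simp only [hY, radialRetraction_of_norm_le hr0 (hle t ht)] at this
    exact this
  · set κ := (1 - r) / (1 + r)
    -- Grönwall's argument for the squared norm; the exponent `2 * κ` becomes the rate `κ` after
    -- taking roots.
    have hanti2 : AntitoneOn (fun s => ‖ξ s‖ ^ 2 * Real.exp (2 * κ * s)) (Icc 0 T) := by
      have hd : ∀ t, HasDerivAt (fun s => Real.exp (2 * κ * s))
          (Real.exp (2 * κ * t) * (2 * κ)) t := fun t => by
        simpa using ((hasDerivAt_id t).const_mul (2 * κ)).exp
      refine antitoneOn_of_hasDerivWithinAt_nonpos (convex_Icc 0 T)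
        ((hcont.norm.pow 2).mul (by fun_prop))
        (fun t ht => ((hsq t (hsub ht)).mul (hd t).hasDerivWithinAt).mono hsub) fun t ht => ?_
      rw [hinner, max_eq_left (hle t (hsub ht)), div_self hr0.ne']
      have h1 := hre t (hsub ht).1 (ξ t)
      have h2 := mul_le_mul_of_nonneg_left h1 (sq_nonneg ‖ξ t‖)
      have h3 := Real.exp_pos (2 * κ * t)
      nlinarith
    have := hanti2 (left_mem_Icc.2 hT) ht ht.1
    simp only [h0', mul_zero, Real.exp_zero, mul_one] at this
    rw [← pow_le_pow_iff_left₀ (norm_nonneg _) (by positivity) two_ne_zero, mul_pow,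
      ← Real.exp_nat_mul]
    rw [← le_div_iff₀ (Real.exp_pos _), div_eq_mul_inv, ← Real.exp_neg] at this
    refine this.trans_eq ?_
    congr 2
    push_cast
    ring

/-- Solutions of the Loewner equation with distinct initial values never meet. -/
theorem loewner_solution_ne {q : ℝ → ℂ → ℂ}
    (hq : ∀ t, 0 ≤ t → DifferentiableOn ℂ (q t) (Metric.ball 0 1))
    (hb : ∀ t, 0 ≤ t → ∀ ξ ∈ Metric.ball (0 : ℂ) 1, ‖q t ξ‖ ≤ ‖ξ‖)
    {r : ℝ} (hr : r < 1) {T : ℝ} {ξ₁ ξ₂ : ℝ → ℂ}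
    (h₁ : ∀ t ∈ Icc 0 T, HasDerivWithinAt ξ₁ (loewnerField q t (ξ₁ t)) (Icc 0 T) t)
    (h₂ : ∀ t ∈ Icc 0 T, HasDerivWithinAt ξ₂ (loewnerField q t (ξ₂ t)) (Icc 0 T) t)
    (hr₁ : ∀ t ∈ Icc 0 T, ‖ξ₁ t‖ ≤ r) (hr₂ : ∀ t ∈ Icc 0 T, ‖ξ₂ t‖ ≤ r)
    (hne : ξ₁ 0 ≠ ξ₂ 0) {t : ℝ} (ht : t ∈ Icc 0 T) : ξ₁ t ≠ ξ₂ t := by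
  intro heq
  apply hne
  obtain ⟨K, hK⟩ := loewnerField_lipschitz hq hb hr
  have hsub : Icc 0 t ⊆ Icc 0 T := Icc_subset_Icc_right ht.2
  have hmem : ∀ s ∈ Ioc 0 t, s ∈ Icc 0 T := fun s hs => hsub (Ioc_subset_Icc_self hs)
  have hnhds : ∀ s ∈ Ioc 0 t, Icc 0 T ∈ 𝓝[Iic s] s := fun s hs =>
    mem_of_superset (Icc_mem_nhdsLE hs.1) (Icc_subset_Icc_right (hmem s hs).2)
  -- Uniqueness is run backwards from the meeting time to time 0.
  exact ODE_solution_unique_of_mem_Icc_left (v := loewnerField q)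
    (s := fun _ => Metric.closedBall 0 r) (K := K)
    (fun s hs => hK s hs.1.le)
    (fun s hs => (h₁ s (hsub hs)).continuousWithinAt.mono hsub)
    (fun s hs => (h₁ s (hmem s hs)).mono_of_mem_nhdsWithin (hnhds s hs))
    (fun s hs => by simpa using hr₁ s (hmem s hs))
    (fun s hs => (h₂ s (hsub hs)).continuousWithinAt.mono hsub)
    (fun s hs => (h₂ s (hmem s hs)).mono_of_mem_nhdsWithin (hnhds s hs))
    (fun s hs => by simpa using hr₂ s (hmem s hs)) heq (left_mem_Icc.2 ht.1)

/-! ### The Schwarz bound for the Loewner quotient. -/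

/-- The quotient governing the Loewner equation, in the coordinate of the unit disc. -/
noncomputable def loewnerQuotient (a B C : ℂ → ℂ) (t : ℝ) (ξ : ℂ) : ℂ :=
  (a (Real.exp (-t) * ξ) - (1 - (Real.exp (-t) : ℂ) ^ 2) * B (Real.exp (-t) * ξ)
    + (1 - (Real.exp (-t) : ℂ) ^ 2) ^ 2 * C (Real.exp (-t) * ξ)) / (Real.exp (-t) : ℂ) ^ 2

theorem exp_neg_mul_mem_ball {t : ℝ} (ht : 0 ≤ t) {ξ : ℂ} (hξ : ξ ∈ Metric.ball (0 : ℂ) 1) :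
    (Real.exp (-t) : ℂ) * ξ ∈ Metric.ball (0 : ℂ) 1 := by
  rw [mem_ball_zero_iff] at *
  rw [norm_mul, Complex.norm_real, Real.norm_of_nonneg (Real.exp_pos _).le]
  have : Real.exp (-t) ≤ 1 := Real.exp_le_one_iff.2 (by linarith)
  nlinarith [norm_nonneg ξ]

theorem exp_neg_ne_zero (t : ℝ) : (Real.exp (-t) : ℂ) ≠ 0 :=
  Complex.ofReal_ne_zero.2 (Real.exp_pos _).ne'

section LoewnerQuotient

variable {a B C : ℂ → ℂ}

theorem loewnerQuotient_differentiableOn (ha : DifferentiableOn ℂ a (Metric.ball 0 1))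
    (hB : DifferentiableOn ℂ B (Metric.ball 0 1)) (hC : DifferentiableOn ℂ C (Metric.ball 0 1))
    {t : ℝ} {s : Set ℂ} (hs : MapsTo (fun ξ => (Real.exp (-t) : ℂ) * ξ) s (Metric.ball 0 1)) :
    DifferentiableOn ℂ (loewnerQuotient a B C t) s := by
  have hm : DifferentiableOn ℂ (fun ξ => (Real.exp (-t) : ℂ) * ξ) s := by fun_prop
  have h1 := ha.comp hm hs
  have h2 := hB.comp hm hs
  have h3 := hC.comp hm hs
  exact ((h1.sub (h2.const_mul _)).add (h3.const_mul _)).div_const _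

theorem loewnerQuotient_continuousOn (ha : DifferentiableOn ℂ a (Metric.ball 0 1))
    (hB : DifferentiableOn ℂ B (Metric.ball 0 1)) (hC : DifferentiableOn ℂ C (Metric.ball 0 1))
    {ξ : ℂ} (hξ : ξ ∈ Metric.ball (0 : ℂ) 1) :
    ContinuousOn (fun t => loewnerQuotient a B C t ξ) (Ici 0) := by
  have he : ContinuousOn (fun t : ℝ => (Real.exp (-t) : ℂ)) (Ici 0) := by fun_prop
  have hm : ContinuousOn (fun t : ℝ => (Real.exp (-t) : ℂ) * ξ) (Ici 0) := by fun_prop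
  have hs : MapsTo (fun t : ℝ => (Real.exp (-t) : ℂ) * ξ) (Ici 0) (Metric.ball 0 1) :=
    fun t ht => exp_neg_mul_mem_ball ht hξ
  have h1 := ha.continuousOn.comp hm hs
  have h2 := hB.continuousOn.comp hm hs
  have h3 := hC.continuousOn.comp hm hs
  have h4 : ContinuousOn (fun t : ℝ => 1 - (Real.exp (-t) : ℂ) ^ 2) (Ici 0) :=
    continuousOn_const.sub (he.pow 2)
  exact ((h1.sub (h4.mul h2)).add ((h4.pow 2).mul h3)).div (he.pow 2)
    fun t _ => pow_ne_zero 2 (exp_neg_ne_zero t)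

/-- For `‖ξ‖ = 1` the point `η = e^{-t} ξ` has modulus `e^{-t}`, so the non-holomorphic factor `1 -
‖η‖²` equals the constant `1 - e^{-2t}` and the hypothesis bounds the quotient by 1. The maximum
principle for the quotient divided by `ξ` does the rest. For `t > 0` the quotient is holomorphic
across the unit circle; `t = 0` follows by continuity in `t`. -/
theorem norm_loewnerQuotient_le (ha : DifferentiableOn ℂ a (Metric.ball 0 1))
    (hB : DifferentiableOn ℂ B (Metric.ball 0 1)) (hC : DifferentiableOn ℂ C (Metric.ball 0 1))
    (ha0 : a 0 = 0) (hB0 : B 0 = 0) (hC0 : C 0 = 0)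
    (hle : ∀ η ∈ Metric.ball (0 : ℂ) 1, η ≠ 0 →
      ‖a η - (1 - (‖η‖ : ℂ) ^ 2) * B η + (1 - (‖η‖ : ℂ) ^ 2) ^ 2 * C η‖ ≤ ‖η‖ ^ 2)
    {t : ℝ} (ht : 0 ≤ t) {ξ : ℂ} (hξ : ξ ∈ Metric.ball (0 : ℂ) 1) :
    ‖loewnerQuotient a B C t ξ‖ ≤ ‖ξ‖ := by
  have hpos : ∀ t : ℝ, 0 < t → ‖loewnerQuotient a B C t ξ‖ ≤ ‖ξ‖ := by
    intro t ht
    set s := Real.exp (-t) with hs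
    have hs0 : 0 < s := Real.exp_pos _
    have hs1 : s < 1 := (Real.exp_lt_exp.2 (by linarith : -t < 0)).trans_eq Real.exp_zero
    have hd : DifferentiableOn ℂ (loewnerQuotient a B C t) (Metric.ball 0 (1 / s)) := by
      refine loewnerQuotient_differentiableOn ha hB hC fun z hz => ?_
      rw [mem_ball_zero_iff] at *
      rw [norm_mul, Complex.norm_real, Real.norm_of_nonneg (Real.exp_pos _).le, ← hs]
      rwa [lt_div_iff₀ hs0, mul_comm] at hz
    have h1s : 1 < 1 / s := (one_lt_div hs0).2 hs1
    have hq0 : loewnerQuotient a B C t 0 = 0 := by simp [loewnerQuotient, ha0, hB0, hC0]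
    have hd' := (Complex.differentiableOn_dslope
      (Metric.ball_mem_nhds (0 : ℂ) (zero_lt_one.trans h1s))).2 hd
    have hsub : Metric.closedBall (0 : ℂ) 1 ⊆ Metric.ball 0 (1 / s) :=
      Metric.closedBall_subset_ball h1s
    have hbd : ∀ z ∈ frontier (Metric.ball (0 : ℂ) 1),
        ‖dslope (loewnerQuotient a B C t) 0 z‖ ≤ 1 := by
      intro z hz
      rw [frontier_ball _ one_ne_zero, mem_sphere_zero_iff_norm] at hz
      have hz0 : z ≠ 0 := by rintro rfl; simp at hz
      rw [dslope_of_ne _ hz0, slope_def_field, hq0, sub_zero, sub_zero, norm_div, hz, div_one,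
        loewnerQuotient, norm_div, norm_pow, Complex.norm_real,
        Real.norm_of_nonneg (Real.exp_pos _).le, ← hs, div_le_one (by positivity)]
      have hn : ‖(s : ℂ) * z‖ = s := by
        rw [norm_mul, hz, Complex.norm_real, Real.norm_of_nonneg hs0.le, mul_one]
      have := hle (s * z) (by rw [mem_ball_zero_iff, hn]; exact hs1)
        (mul_ne_zero (Complex.ofReal_ne_zero.2 hs0.ne') hz0)
      rwa [hn] at this
    have := Complex.norm_le_of_forall_mem_frontier_norm_le Metric.isBounded_ball
      ((hd'.mono hsub).diffContOnCl_ball subset_rfl) hbd (subset_closure hξ)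
    by_cases hξ0 : ξ = 0
    · simp [hξ0, hq0]
    rw [dslope_of_ne _ hξ0, slope_def_field, hq0, sub_zero, sub_zero, norm_div,
      div_le_one (norm_pos_iff.2 hξ0)] at this
    exact this
  have hcl : ContinuousOn (fun t => ‖loewnerQuotient a B C t ξ‖) (Ici 0) :=
    (loewnerQuotient_continuousOn ha hB hC hξ).norm
  rcases ht.eq_or_lt with rfl | ht
  · refine le_of_tendsto ((hcl 0 self_mem_Ici).mono Ioi_subset_Ici_self).tendsto ?_
    filter_upwards [self_mem_nhdsWithin] with s hs using hpos s hs
  · exact hpos t ht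

end LoewnerQuotient

/-! ### The coordinate at infinity and the Riccati curves. -/

open Classical in
/-- A function on the exterior disc read in the coordinate `1 / ζ`, with value `0` at infinity. -/
noncomputable def atInv (F : ℂ → ℂ) (η : ℂ) : ℂ := if η = 0 then 0 else F η⁻¹

theorem atInv_zero (F : ℂ → ℂ) : atInv F 0 = 0 := if_pos rfl

theorem atInv_of_ne (F : ℂ → ℂ) {η : ℂ} (h : η ≠ 0) : atInv F η = F η⁻¹ := if_neg h

theorem inv_mem_exteriorDisk {η : ℂ} (h : η ∈ Metric.ball (0 : ℂ) 1) (h0 : η ≠ 0) :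
    η⁻¹ ∈ exteriorDisk := by
  rw [mem_ball_zero_iff] at h
  change 1 < ‖η⁻¹‖
  rw [norm_inv]
  exact (one_lt_inv₀ (norm_pos_iff.2 h0)).2 h

theorem isOpen_exteriorDisk : IsOpen exteriorDisk := isOpen_lt continuous_const continuous_norm

theorem ne_zero_of_mem_exteriorDisk {z : ℂ} (hz : z ∈ exteriorDisk) : z ≠ 0 :=
  norm_pos_iff.1 (zero_lt_one.trans hz)

theorem differentiableOn_atInv {F : ℂ → ℂ} (hF : DifferentiableOn ℂ F exteriorDisk)
    (h0 : Tendsto F (Bornology.cobounded ℂ) (𝓝 0)) :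
    DifferentiableOn ℂ (atInv F) (Metric.ball 0 1) := by
  refine (Complex.differentiableOn_compl_singleton_and_continuousAt_iff
    (Metric.ball_mem_nhds (0 : ℂ) one_pos)).1 ⟨?_, ?_⟩
  · have : DifferentiableOn ℂ (fun η => F η⁻¹) (Metric.ball 0 1 \ {0}) :=
      hF.comp (differentiableOn_inv.mono fun z hz => hz.2)
        fun z hz => inv_mem_exteriorDisk hz.1 hz.2
    exact this.congr fun z hz => atInv_of_ne F hz.2
  · rw [← continuousWithinAt_compl_self, ContinuousWithinAt, atInv_zero]
    refine (h0.comp tendsto_inv₀_nhdsNE_zero).congr' ?_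
    filter_upwards [self_mem_nhdsWithin] with η hη using (atInv_of_ne F hη).symm

/-- A curve `Z` in the exterior disc such that `Z` and `X = (e^{-2t} - 1) Z` satisfy the Riccati
equation `dX / dZ = -(1 / h + b X + c X²)`. -/
structure IsRiccatiCurve (h b c : ℂ → ℂ) (T : ℝ) (Z Z' : ℝ → ℂ) : Prop where
  norm_le : ∀ t ∈ Icc 0 T, ‖Z 0‖ ≤ ‖Z t‖
  hasDeriv : ∀ t ∈ Icc 0 T, HasDerivWithinAt Z (Z' t) (Icc 0 T) t
  hasDeriv_mul : ∀ t ∈ Icc 0 T,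
    HasDerivWithinAt (fun t => ((Real.exp (-t) : ℂ) ^ 2 - 1) * Z t)
      (-(Z' t * (1 / h (Z t) + b (Z t) * (((Real.exp (-t) : ℂ) ^ 2 - 1) * Z t)
        + c (Z t) * (((Real.exp (-t) : ℂ) ^ 2 - 1) * Z t) ^ 2))) (Icc 0 T) t
  bounded : ∃ M : ℝ, ∀ t ∈ Icc 0 T, ‖Z' t‖ ≤ M

section RiccatiFlow

variable {h b c : ℂ → ℂ}

/-- For `Z = 1 / (e^{-t} ξ)` the Loewner equation gives `Z' = 2 Z / (1 + q)`, hence `X' = -Z' (1 + q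
e^{-2t})` for `X = (e^{-2t} - 1) Z`. By definition of `q`, the bracket is `1/h + b X + c X²`. -/
theorem isRiccatiCurve_of_loewner (hne : ∀ z ∈ exteriorDisk, h z ≠ 0) {T r : ℝ} (hr : r < 1)
    {ξ : ℝ → ℂ} {q : ℝ → ℂ → ℂ}
    (hq : q = loewnerQuotient (atInv fun z => (1 - h z) / h z) (atInv fun z => z * b z)
      (atInv fun z => z ^ 2 * c z))
    (hb : ∀ t, 0 ≤ t → ∀ ξ ∈ Metric.ball (0 : ℂ) 1, ‖q t ξ‖ ≤ ‖ξ‖)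
    (hξ : ∀ t ∈ Icc 0 T, HasDerivWithinAt ξ (loewnerField q t (ξ t)) (Icc 0 T) t)
    (hξ0 : ∀ t ∈ Icc 0 T, ξ t ≠ 0) (hξr : ∀ t ∈ Icc 0 T, ‖ξ t‖ ≤ r)
    (hξi : ∀ t ∈ Icc 0 T, ‖ξ t‖ ≤ ‖ξ 0‖) :
    ∃ Z', IsRiccatiCurve h b c T (fun t => (Real.exp (-t) * ξ t : ℂ)⁻¹) Z' := by
  have hmem : ∀ t ∈ Icc 0 T, ξ t ∈ Metric.ball (0 : ℂ) 1 := fun t ht => by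
    simpa using (hξr t ht).trans_lt hr
  have hq1 : ∀ t ∈ Icc 0 T, ‖q t (ξ t)‖ ≤ r := fun t ht =>
    (hb t ht.1 _ (hmem t ht)).trans (hξr t ht)
  have hqne : ∀ t ∈ Icc 0 T, 1 + q t (ξ t) ≠ 0 := fun t ht =>
    one_add_ne_zero_of_norm_lt ((hq1 t ht).trans_lt hr)
  have he : ∀ t : ℝ, HasDerivAt (fun t : ℝ => (Real.exp (-t) : ℂ)) (-(Real.exp (-t) : ℂ)) t := by
    intro t
    have h1 : HasDerivAt (fun t : ℝ => Real.exp (-t)) (-Real.exp (-t)) t := by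
      simpa using (hasDerivAt_neg t).exp
    simpa using h1.ofReal_comp
  set Z : ℝ → ℂ := fun t => (Real.exp (-t) * ξ t : ℂ)⁻¹ with hZ
  have hZd : ∀ t ∈ Icc 0 T, HasDerivWithinAt Z (2 * Z t / (1 + q t (ξ t))) (Icc 0 T) t := by
    intro t ht
    have h1 := (((he t).hasDerivWithinAt (s := Icc 0 T)).mul (hξ t ht)).inv
      (mul_ne_zero (exp_neg_ne_zero t) (hξ0 t ht))
    refine h1.congr_deriv ?_
    simp only [Pi.mul_apply, hZ, loewnerField]
    have := exp_neg_ne_zero t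
    have := hξ0 t ht
    have := hqne t ht
    field_simp
    ring
  refine ⟨fun t => 2 * Z t / (1 + q t (ξ t)), fun t ht => ?_, hZd, fun t ht => ?_, ?_⟩
  · simp only [hZ, norm_inv, norm_mul, Complex.norm_real, Real.norm_of_nonneg (Real.exp_pos _).le]
    have h0 := norm_pos_iff.2 (hξ0 t ht)
    have h1 : Real.exp (-t) ≤ 1 := Real.exp_le_one_iff.2 (by linarith [ht.1])
    rw [neg_zero, Real.exp_zero, one_mul]
    gcongr
    calc Real.exp (-t) * ‖ξ t‖ ≤ 1 * ‖ξ 0‖ := by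
          gcongr
          exact hξi t ht
      _ = _ := one_mul _
  · have h1 := ((((he t).pow 2).sub_const 1).hasDerivWithinAt (s := Icc 0 T)).mul (hZd t ht)
    refine h1.congr_deriv ?_
    have hη : (Real.exp (-t) * ξ t : ℂ) ≠ 0 := mul_ne_zero (exp_neg_ne_zero t) (hξ0 t ht)
    have hZ0 : Z t ≠ 0 := inv_ne_zero hη
    have hZm : Z t ∈ exteriorDisk :=
      inv_mem_exteriorDisk (exp_neg_mul_mem_ball ht.1 (hmem t ht)) hη
    have hqe : q t (ξ t) * (Real.exp (-t) : ℂ) ^ 2 = (1 - h (Z t)) / h (Z t)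
        - (1 - (Real.exp (-t) : ℂ) ^ 2) * (Z t * b (Z t))
        + (1 - (Real.exp (-t) : ℂ) ^ 2) ^ 2 * (Z t ^ 2 * c (Z t)) := by
      rw [hq, loewnerQuotient, div_mul_cancel₀ _ (pow_ne_zero 2 (exp_neg_ne_zero t)),
        atInv_of_ne _ hη, atInv_of_ne _ hη, atInv_of_ne _ hη]
    have e1 : (1 - h (Z t)) / h (Z t) = 1 / h (Z t) - 1 := by
      rw [sub_div, div_self (hne _ hZm)]
    rw [e1] at hqe
    have h2 := hqne t ht
    have h3 : 1 / h (Z t) + b (Z t) * (((Real.exp (-t) : ℂ) ^ 2 - 1) * Z t)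
        + c (Z t) * (((Real.exp (-t) : ℂ) ^ 2 - 1) * Z t) ^ 2
        = 1 + q t (ξ t) * (Real.exp (-t) : ℂ) ^ 2 := by
      rw [hqe]; ring
    rw [h3]
    simp only [Pi.pow_apply, Nat.cast_ofNat]
    field_simp
    ring
  · have hcont : ContinuousOn Z (Icc 0 T) := fun t ht => (hZd t ht).continuousWithinAt
    obtain ⟨M, hM⟩ := isCompact_Icc.exists_bound_of_continuousOn hcont
    refine ⟨2 * M / (1 - r), fun t ht => ?_⟩
    have h1 : 1 - r ≤ ‖1 + q t (ξ t)‖ := by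
      have := norm_sub_norm_le (1 : ℂ) (-q t (ξ t))
      rw [norm_one, norm_neg, sub_neg_eq_add] at this
      linarith [hq1 t ht]
    have h2 := hM t ht
    have h3 : 0 < 1 - r := by linarith
    rw [norm_div, norm_mul, Complex.norm_ofNat]
    have : 0 ≤ M := (norm_nonneg _).trans h2
    gcongr

/-- Two Riccati curves starting at distinct points stay distinct; `e^{-t} |Z|` becomes large. -/
theorem exists_riccatiCurves (hh : DifferentiableOn ℂ h exteriorDisk)
    (hb : DifferentiableOn ℂ b exteriorDisk) (hc : DifferentiableOn ℂ c exteriorDisk)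
    (hne : ∀ z ∈ exteriorDisk, h z ≠ 0)
    (hlim : Tendsto (fun z => (1 - h z) / h z) (Bornology.cobounded ℂ) (𝓝 0))
    (hblim : Tendsto (fun z => z * b z) (Bornology.cobounded ℂ) (𝓝 0))
    (hclim : Tendsto (fun z => z ^ 2 * c z) (Bornology.cobounded ℂ) (𝓝 0))
    (hineq : ∀ z ∈ exteriorDisk,
      ‖(1 - h z) / h z * (‖z‖ : ℂ) ^ 2 - ((‖z‖ : ℂ) ^ 2 - 1) * (z * b z)
        + ((‖z‖ : ℂ) ^ 2 - 1) ^ 2 * (z / starRingEnd ℂ z) * c z‖ ≤ 1)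
    {z₁ z₂ : ℂ} (h₁ : z₁ ∈ exteriorDisk) (h₂ : z₂ ∈ exteriorDisk) (h₁₂ : z₁ ≠ z₂)
    {ε : ℝ} (hε : 0 < ε) :
    ∃ T : ℝ, 0 ≤ T ∧ Real.exp (-T) < ε ∧ ∃ Z₁ Z₁' Z₂ Z₂' : ℝ → ℂ,
      IsRiccatiCurve h b c T Z₁ Z₁' ∧ IsRiccatiCurve h b c T Z₂ Z₂' ∧
      Z₁ 0 = z₁ ∧ Z₂ 0 = z₂ ∧ Z₁ T ≠ Z₂ T ∧
      Z₁ T ∈ exteriorDisk ∧ Z₂ T ∈ exteriorDisk ∧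
      ‖(Z₁ T)⁻¹‖ < ε * Real.exp (-T) ∧ ‖(Z₂ T)⁻¹‖ < ε * Real.exp (-T) := by
  have hA := differentiableOn_atInv (F := fun z => (1 - h z) / h z) ((hh.const_sub 1).div hh hne) hlim
  have hB := differentiableOn_atInv (F := fun z => z * b z) (differentiableOn_id.mul hb) hblim
  have hC := differentiableOn_atInv (F := fun z => z ^ 2 * c z) ((differentiableOn_id.pow 2).mul hc) hclim
  obtain ⟨q, hq⟩ : ∃ q, q = loewnerQuotient (atInv fun z => (1 - h z) / h z)
    (atInv fun z => z * b z) (atInv fun z => z ^ 2 * c z) := ⟨_, rfl⟩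
  have hqd : ∀ t, 0 ≤ t → DifferentiableOn ℂ (q t) (Metric.ball 0 1) := fun t ht => by
    rw [hq]
    exact loewnerQuotient_differentiableOn hA hB hC fun ξ hξ => exp_neg_mul_mem_ball ht hξ
  have hqb : ∀ t, 0 ≤ t → ∀ ξ ∈ Metric.ball (0 : ℂ) 1, ‖q t ξ‖ ≤ ‖ξ‖ := fun t ht ξ hξ => by
    rw [hq]
    refine norm_loewnerQuotient_le hA hB hC (atInv_zero _) (atInv_zero _) (atInv_zero _)
      (fun η hη hη0 => ?_) ht hξ
    have h3 := hineq _ (inv_mem_exteriorDisk hη hη0)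
    rw [atInv_of_ne _ hη0, atInv_of_ne _ hη0, atInv_of_ne _ hη0]
    have hn : (‖η‖ : ℂ) ≠ 0 := Complex.ofReal_ne_zero.2 (norm_ne_zero_iff.2 hη0)
    have hconj : starRingEnd ℂ η * η = (‖η‖ : ℂ) ^ 2 := Complex.conj_mul' η
    have hc0 : starRingEnd ℂ η ≠ 0 := (map_ne_zero _).2 hη0
    set z := η⁻¹ with hz
    -- With this identity the expression in `η` is `‖η‖²` times the criterion at `1 / η`.
    have hzz : z / starRingEnd ℂ z = z ^ 2 * (‖η‖ : ℂ) ^ 2 := by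
      rw [← hconj, hz, map_inv₀]; field_simp
    have e : (1 - h z) / h z - (1 - (‖η‖ : ℂ) ^ 2) * (z * b z)
          + (1 - (‖η‖ : ℂ) ^ 2) ^ 2 * (z ^ 2 * c z)
        = (‖η‖ : ℂ) ^ 2 * ((1 - h z) / h z * (‖z‖ : ℂ) ^ 2 - ((‖z‖ : ℂ) ^ 2 - 1) * (z * b z)
          + ((‖z‖ : ℂ) ^ 2 - 1) ^ 2 * (z / starRingEnd ℂ z) * c z) := by
      rw [hzz, hz, norm_inv, ← hz]
      generalize (1 - h z) / h z = A
      push_cast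
      field_simp
    rw [e, norm_mul, norm_pow, Complex.norm_real, norm_norm]
    exact mul_le_of_le_one_right (by positivity) h3
  have hqc : ∀ ξ ∈ Metric.ball (0 : ℂ) 1, ContinuousOn (fun t => q t ξ) (Ici 0) := fun ξ hξ => by
    rw [hq]; exact loewnerQuotient_continuousOn hA hB hC hξ
  have hinv : ∀ z ∈ exteriorDisk, ‖z⁻¹‖ < 1 := fun z hz => by
    rw [norm_inv]; exact inv_lt_one_of_one_lt₀ hz
  set r := max ‖z₁⁻¹‖ ‖z₂⁻¹‖ with hr
  have hr1 : r < 1 := max_lt (hinv _ h₁) (hinv _ h₂)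
  have hr0 : 0 < r := lt_max_of_lt_left
    (norm_pos_iff.2 (inv_ne_zero (ne_zero_of_mem_exteriorDisk h₁)))
  set κ := (1 - r) / (1 + r) with hκ
  have hκ0 : 0 < κ := div_pos (by linarith) (by linarith)
  have ht1 : Tendsto (fun T : ℝ => Real.exp (-T)) atTop (𝓝 0) :=
    Real.tendsto_exp_neg_atTop_nhds_zero
  have ht2 : Tendsto (fun T : ℝ => Real.exp (-κ * T)) atTop (𝓝 0) :=
    Real.tendsto_exp_atBot.comp (tendsto_id.const_mul_atTop_of_neg (by linarith))
  -- Since `1 / Z = e^{-T} ξ`, the condition `e^{-κT} < ε` yields `‖1 / Z‖ < ε e^{-T}`, the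
  -- smallness needed for separation.
  obtain ⟨T, hT1, hT2, hT⟩ := ((ht1.eventually (gt_mem_nhds hε)).and
    ((ht2.eventually (gt_mem_nhds hε)).and (eventually_ge_atTop 0))).exists
  have hex : ∀ z ∈ exteriorDisk, ‖z⁻¹‖ ≤ r → ∃ ξ : ℝ → ℂ, ξ 0 = z⁻¹ ∧
      ∀ t ∈ Icc 0 T, HasDerivWithinAt ξ (loewnerField q t (ξ t)) (Icc 0 T) t ∧
        ‖ξ t‖ ≤ ‖z⁻¹‖ * Real.exp (-κ * t) := fun z hz hzr =>
    exists_loewner_solution hqd hqb hqc hr0 hr1 hzr hT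
  obtain ⟨ξ₁, i₁, s₁⟩ := hex z₁ h₁ (le_max_left _ _)
  obtain ⟨ξ₂, i₂, s₂⟩ := hex z₂ h₂ (le_max_right _ _)
  have hdec : ∀ z : ℂ, ∀ t ∈ Icc 0 T, ‖z⁻¹‖ * Real.exp (-κ * t) ≤ ‖z⁻¹‖ := fun z t ht =>
    mul_le_of_le_one_right (norm_nonneg _)
      (Real.exp_le_one_iff.2 (by nlinarith [ht.1]))
  have hTm : T ∈ Icc 0 T := right_mem_Icc.2 hT
  have d₁ : ∀ t ∈ Icc 0 T, ‖ξ₁ t‖ ≤ ‖z₁⁻¹‖ := fun t ht => (s₁ t ht).2.trans (hdec _ t ht)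
  have d₂ : ∀ t ∈ Icc 0 T, ‖ξ₂ t‖ ≤ ‖z₂⁻¹‖ := fun t ht => (s₂ t ht).2.trans (hdec _ t ht)
  have r₁ : ∀ t ∈ Icc 0 T, ‖ξ₁ t‖ ≤ r := fun t ht => (d₁ t ht).trans (le_max_left _ _)
  have r₂ : ∀ t ∈ Icc 0 T, ‖ξ₂ t‖ ≤ r := fun t ht => (d₂ t ht).trans (le_max_right _ _)
  -- The zero function solves the equation, so uniqueness keeps the other solutions away from 0.
  have hne0 : ∀ ξ : ℝ → ℂ, (∀ t ∈ Icc 0 T,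
      HasDerivWithinAt ξ (loewnerField q t (ξ t)) (Icc 0 T) t) → (∀ t ∈ Icc 0 T, ‖ξ t‖ ≤ r) →
      ξ 0 ≠ 0 → ∀ t ∈ Icc 0 T, ξ t ≠ 0 := fun ξ hξ hξr hξ0 t ht =>
    loewner_solution_ne hqd hqb hr1 hξ
      (ξ₂ := fun _ => 0) (fun t ht => by simpa [loewnerField] using hasDerivWithinAt_const _ _ _)
      hξr (fun t ht => by simpa using hr0.le) hξ0 ht
  have n₁ := hne0 ξ₁ (fun t ht => (s₁ t ht).1) r₁
    (by rw [i₁]; exact inv_ne_zero (ne_zero_of_mem_exteriorDisk h₁))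
  have n₂ := hne0 ξ₂ (fun t ht => (s₂ t ht).1) r₂
    (by rw [i₂]; exact inv_ne_zero (ne_zero_of_mem_exteriorDisk h₂))
  have hne12 : ξ₁ T ≠ ξ₂ T := loewner_solution_ne hqd hqb hr1 (fun t ht => (s₁ t ht).1)
    (fun t ht => (s₂ t ht).1) r₁ r₂ (by rw [i₁, i₂]; exact inv_injective.ne h₁₂) hTm
  obtain ⟨Z₁', c₁⟩ := isRiccatiCurve_of_loewner hne hr1 hq hqb (fun t ht => (s₁ t ht).1) n₁ r₁
    (by rw [i₁]; exact d₁)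
  obtain ⟨Z₂', c₂⟩ := isRiccatiCurve_of_loewner hne hr1 hq hqb (fun t ht => (s₂ t ht).1) n₂ r₂
    (by rw [i₂]; exact d₂)
  have hsmall : ∀ (ξ : ℝ → ℂ) (z : ℂ), z ∈ exteriorDisk →
      ‖ξ T‖ ≤ ‖z⁻¹‖ * Real.exp (-κ * T) →
      ‖((Real.exp (-T) * ξ T : ℂ)⁻¹)⁻¹‖ < ε * Real.exp (-T) := by
    intro ξ z hz hle
    rw [inv_inv, norm_mul, Complex.norm_real, Real.norm_of_nonneg (Real.exp_pos _).le, mul_comm]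
    refine mul_lt_mul_of_pos_right ?_ (Real.exp_pos _)
    refine (hle.trans ?_).trans_lt hT2
    exact mul_le_of_le_one_left (Real.exp_pos _).le (hinv z hz).le
  have hext : ∀ ξ : ℝ → ℂ, ‖ξ T‖ ≤ r → ξ T ≠ 0 →
      (Real.exp (-T) * ξ T : ℂ)⁻¹ ∈ exteriorDisk := fun ξ hξ h0 =>
    inv_mem_exteriorDisk (exp_neg_mul_mem_ball hT (by simpa using hξ.trans_lt hr1))
      (mul_ne_zero (exp_neg_ne_zero T) h0)
  refine ⟨T, hT, hT1, _, Z₁', _, Z₂', c₁, c₂, by simp [i₁], by simp [i₂], ?_,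
    hext ξ₁ (r₁ T hTm) (n₁ T hTm), hext ξ₂ (r₂ T hTm) (n₂ T hTm),
    hsmall ξ₁ z₁ h₁ (s₁ T hTm).2, hsmall ξ₂ z₂ h₂ (s₂ T hTm).2⟩
  exact inv_injective.ne fun hE => hne12 (mul_left_cancel₀ (exp_neg_ne_zero T) hE)

end RiccatiFlow

/-! ### The projective first integral. -/

/-- The coordinate `y (1 - x h κ) + x h y'` of the projective first integral of the Riccati
equation. -/
noncomputable def riccatiLift (h κ y : ℂ → ℂ) (z x : ℂ) : ℂ :=
  y z * (1 - x * h z * κ z) + x * h z * deriv y z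

section FirstIntegral

variable {h b c κ L ν : ℂ → ℂ} {T : ℝ} {Z Z' : ℝ → ℂ}

/-- The formulas for `b` and `c` are what makes the derivative a multiple of the lift. The
multiplier does not involve `y`, so lifts of two solutions of the same linear equation have a
constant ratio. -/
theorem hasDerivWithinAt_riccatiLift (hZ : IsRiccatiCurve h b c T Z Z') {y : ℂ → ℂ} {t : ℝ}
    (ht : t ∈ Icc 0 T) (hh : AnalyticAt ℂ h (Z t)) (hκ : AnalyticAt ℂ κ (Z t))
    (hy : AnalyticAt ℂ y (Z t)) (hh0 : h (Z t) ≠ 0)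
    (hb : b (Z t) = deriv h (Z t) / h (Z t) + L (Z t) - 2 * κ (Z t))
    (hc : c (Z t) = h (Z t) * (deriv κ (Z t) + κ (Z t) ^ 2 - κ (Z t) * L (Z t) - ν (Z t)))
    (hyy : deriv (deriv y) (Z t) = L (Z t) * deriv y (Z t) + ν (Z t) * y (Z t)) :
    HasDerivWithinAt
      (fun t => riccatiLift h κ y (Z t) (((Real.exp (-t) : ℂ) ^ 2 - 1) * Z t))
      (Z' t * (κ (Z t) - c (Z t) * (((Real.exp (-t) : ℂ) ^ 2 - 1) * Z t))
        * riccatiLift h κ y (Z t) (((Real.exp (-t) : ℂ) ^ 2 - 1) * Z t)) (Icc 0 T) t := by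
  have dZ := hZ.hasDeriv t ht
  have dX := hZ.hasDeriv_mul t ht
  have d1 := hh.differentiableAt.hasDerivAt.comp_hasDerivWithinAt t dZ
  have d2 := hκ.differentiableAt.hasDerivAt.comp_hasDerivWithinAt t dZ
  have d3 := hy.differentiableAt.hasDerivAt.comp_hasDerivWithinAt t dZ
  have d4 := hy.deriv.differentiableAt.hasDerivAt.comp_hasDerivWithinAt t dZ
  have := (d3.mul (((dX.mul d1).mul d2).const_sub 1)).add ((dX.mul d1).mul d4)
  refine this.congr_deriv ?_
  simp only [Pi.mul_apply, Function.comp_apply, riccatiLift]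
  rw [hb, hyy, hc]
  generalize ((Real.exp (-t) : ℂ) ^ 2 - 1) * Z t = x
  field_simp
  ring

/-- If the two Riccati curves start on the same level of `u / v`, then they stay on the same level
of the first integral. -/
theorem riccatiLift_cross_eq {Ω : Set ℂ} {u v : ℂ → ℂ} {Z₁ Z₁' Z₂ Z₂' : ℝ → ℂ}
    (hT : 0 ≤ T)
    (hZ₁ : IsRiccatiCurve h b c T Z₁ Z₁') (hZ₂ : IsRiccatiCurve h b c T Z₂ Z₂')
    (hΩ₁ : ∀ t ∈ Icc 0 T, Z₁ t ∈ Ω) (hΩ₂ : ∀ t ∈ Icc 0 T, Z₂ t ∈ Ω)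
    (hh : AnalyticOnNhd ℂ h Ω) (hκ : AnalyticOnNhd ℂ κ Ω) (hca : AnalyticOnNhd ℂ c Ω)
    (hu : AnalyticOnNhd ℂ u Ω) (hv : AnalyticOnNhd ℂ v Ω) (hh0 : ∀ z ∈ Ω, h z ≠ 0)
    (hb : ∀ z ∈ Ω, b z = deriv h z / h z + L z - 2 * κ z)
    (hc : ∀ z ∈ Ω, c z = h z * (deriv κ z + κ z ^ 2 - κ z * L z - ν z))
    (huu : ∀ z ∈ Ω, deriv (deriv u) z = L z * deriv u z + ν z * u z)
    (hvv : ∀ z ∈ Ω, deriv (deriv v) z = L z * deriv v z + ν z * v z)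
    (h0 : u (Z₁ 0) * v (Z₂ 0) = u (Z₂ 0) * v (Z₁ 0)) :
    riccatiLift h κ u (Z₁ T) (((Real.exp (-T) : ℂ) ^ 2 - 1) * Z₁ T)
        * riccatiLift h κ v (Z₂ T) (((Real.exp (-T) : ℂ) ^ 2 - 1) * Z₂ T)
      = riccatiLift h κ u (Z₂ T) (((Real.exp (-T) : ℂ) ^ 2 - 1) * Z₂ T)
        * riccatiLift h κ v (Z₁ T) (((Real.exp (-T) : ℂ) ^ 2 - 1) * Z₁ T) := by
  set Λ : (ℝ → ℂ) → ℝ → ℂ :=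
    fun Z t => κ (Z t) - c (Z t) * (((Real.exp (-t) : ℂ) ^ 2 - 1) * Z t) with hΛ
  have key : ∀ {Z Z' : ℝ → ℂ}, IsRiccatiCurve h b c T Z Z' → (∀ t ∈ Icc 0 T, Z t ∈ Ω) →
      ∃ M : ℝ, 0 ≤ M ∧ ∀ t ∈ Icc 0 T, ‖Z' t * Λ Z t‖ ≤ M := by
    intro Z Z' hZ hΩ
    have hcont : ContinuousOn Z (Icc 0 T) := fun t ht => (hZ.hasDeriv t ht).continuousWithinAt
    have hX : ContinuousOn (fun t => ((Real.exp (-t) : ℂ) ^ 2 - 1) * Z t) (Icc 0 T) :=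
      fun t ht => (hZ.hasDeriv_mul t ht).continuousWithinAt
    have hΛc : ContinuousOn (Λ Z) (Icc 0 T) :=
      (hκ.continuousOn.comp hcont hΩ).sub ((hca.continuousOn.comp hcont hΩ).mul hX)
    obtain ⟨M₁, hM₁⟩ := hZ.bounded
    obtain ⟨M₂, hM₂⟩ := isCompact_Icc.exists_bound_of_continuousOn hΛc
    refine ⟨|M₁| * |M₂|, by positivity, fun t ht => ?_⟩
    rw [norm_mul]
    exact mul_le_mul ((hM₁ t ht).trans (le_abs_self _)) ((hM₂ t ht).trans (le_abs_self _))
      (norm_nonneg _) (abs_nonneg _)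
  obtain ⟨M₁, hM₁0, hM₁⟩ := key hZ₁ hΩ₁
  obtain ⟨M₂, hM₂0, hM₂⟩ := key hZ₂ hΩ₂
  set N : (ℂ → ℂ) → (ℝ → ℂ) → ℝ → ℂ :=
    fun y Z t => riccatiLift h κ y (Z t) (((Real.exp (-t) : ℂ) ^ 2 - 1) * Z t) with hN
  have dN : ∀ {y : ℂ → ℂ} {Z Z' : ℝ → ℂ}, AnalyticOnNhd ℂ y Ω →
      (∀ z ∈ Ω, deriv (deriv y) z = L z * deriv y z + ν z * y z) →
      IsRiccatiCurve h b c T Z Z' → (∀ t ∈ Icc 0 T, Z t ∈ Ω) → ∀ t ∈ Icc 0 T,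
      HasDerivWithinAt (N y Z) (Z' t * Λ Z t * N y Z t) (Icc 0 T) t :=
    fun hy hyy hZ hΩ t ht => hasDerivWithinAt_riccatiLift hZ ht (hh _ (hΩ t ht)) (hκ _ (hΩ t ht))
      (hy _ (hΩ t ht)) (hh0 _ (hΩ t ht)) (hb _ (hΩ t ht)) (hc _ (hΩ t ht)) (hyy _ (hΩ t ht))
  have dW : ∀ t ∈ Icc 0 T, HasDerivWithinAt (fun t => N u Z₁ t * N v Z₂ t - N u Z₂ t * N v Z₁ t)
      ((Z₁' t * Λ Z₁ t + Z₂' t * Λ Z₂ t) * (N u Z₁ t * N v Z₂ t - N u Z₂ t * N v Z₁ t))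
      (Icc 0 T) t := by
    intro t ht
    have := ((dN hu huu hZ₁ hΩ₁ t ht).mul (dN hv hvv hZ₂ hΩ₂ t ht)).sub
      ((dN hu huu hZ₂ hΩ₂ t ht).mul (dN hv hvv hZ₁ hΩ₁ t ht))
    exact this.congr_deriv (by ring)
  -- The cross difference solves a homogeneous linear equation with bounded coefficient. It vanishes
  -- at time 0, where `x = 0` and each lift is `y` itself.
  have hW := eq_zero_of_abs_deriv_le_mul_abs_self_of_eq_zero_right (K := M₁ + M₂)
    (fun t ht => (dW t ht).continuousWithinAt)
    (fun t ht => (dW t (Ico_subset_Icc_self ht)).mono_of_mem_nhdsWithin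
      (Icc_mem_nhdsGE_of_mem ht))
    (by simp [hN, riccatiLift, h0])
    (fun t ht => by
      rw [norm_mul]
      gcongr
      exact (norm_add_le _ _).trans (add_le_add (hM₁ t (Ico_subset_Icc_self ht))
        (hM₂ t (Ico_subset_Icc_self ht)))) T (right_mem_Icc.2 hT)
  exact sub_eq_zero.1 hW

end FirstIntegral

/-! ### Local behaviour of univalent functions at regular points and poles. -/

/-- An injective holomorphic function has nonvanishing derivative. -/
theorem deriv_ne_zero_of_injOn_nhds {f : ℂ → ℂ} {z₀ : ℂ} (hf : AnalyticAt ℂ f z₀) {V : Set ℂ}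
    (hV : V ∈ 𝓝 z₀) (hinj : InjOn f V) : deriv f z₀ ≠ 0 := by
  have hnc : ∀ z, V ∈ 𝓝 z → ¬ ∀ᶠ w in 𝓝 z, f w = f z := by
    intro z hz hc
    have : ∀ᶠ w in 𝓝 z, w = z := by
      filter_upwards [hc, hz] with w hw hwV using hinj hwV (mem_of_mem_nhds hz) hw
    obtain ⟨w, hw, hne⟩ := ((this.filter_mono nhdsWithin_le_nhds).and
      (self_mem_nhdsWithin : ∀ᶠ w in 𝓝[≠] z, w ≠ z)).exists
    exact hne hw
  have hd : ∀ᶠ z in 𝓝 z₀, z ≠ z₀ → deriv f z ≠ 0 := by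
    rcases hf.deriv.eventually_eq_zero_or_eventually_ne_zero with h0 | h0
    · exfalso
      obtain ⟨ε, hε, hball⟩ := Metric.eventually_nhds_iff_ball.1 (h0.and hf.eventually_analyticAt)
      refine hnc z₀ hV ?_
      filter_upwards [Metric.ball_mem_nhds z₀ hε] with w hw
      exact Metric.isOpen_ball.is_const_of_deriv_eq_zero (convex_ball z₀ ε).isPreconnected
        (fun z hz => (hball z hz).2.differentiableAt.differentiableWithinAt)
        (fun z hz => (hball z hz).1) hw (Metric.mem_ball_self hε)
    · exact eventually_nhdsWithin_iff.1 h0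
  obtain ⟨ε, hε, hball⟩ := Metric.eventually_nhds_iff_ball.1
    ((hd.and hf.eventually_analyticAt).and (eventually_mem_nhds_iff.2 hV))
  set B := Metric.ball z₀ ε with hB
  have hBo : IsOpen B := Metric.isOpen_ball
  have hBV : B ⊆ V := fun z hz => mem_of_mem_nhds (hball z hz).2
  have hz₀ : z₀ ∈ B := Metric.mem_ball_self hε
  have hopen : ∀ z ∈ B, ∀ N ∈ 𝓝 z, f '' N ∈ 𝓝 (f z) := fun z hz N hN =>
    ((hball z hz).1.2.eventually_constant_or_nhds_le_map_nhds.resolve_left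
      (hnc z (hball z hz).2)) (image_mem_map hN)
  set g := Function.invFunOn f B with hg
  have hgf : ∀ z ∈ B, g (f z) = z := fun z hz =>
    (hinj.mono hBV).leftInvOn_invFunOn hz
  have hgc : ∀ z ∈ B, ContinuousAt g (f z) := by
    intro z hz N hN
    rw [hgf z hz] at hN
    rw [mem_map]
    filter_upwards [hopen z hz _ (inter_mem hN (hBo.mem_nhds hz))]
    rintro _ ⟨w, hw, rfl⟩
    simpa [hgf w hw.2] using hw.1
  -- The inverse is differentiable off `f z₀` and continuous there, so the singularity is removable;
  -- the chain rule for `g ∘ f = id` then rules out a zero derivative.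
  have hga : AnalyticAt ℂ g (f z₀) := by
    refine Complex.analyticAt_of_differentiable_on_punctured_nhds_of_continuousAt ?_ (hgc z₀ hz₀)
    rw [eventually_nhdsWithin_iff]
    filter_upwards [hopen z₀ hz₀ _ (hBo.mem_nhds hz₀)]
    rintro _ ⟨w, hw, rfl⟩ hne
    have hw0 : w ≠ z₀ := by rintro rfl; exact hne rfl
    refine (HasDerivAt.of_local_left_inverse (f := f) (f' := deriv f w) (hgc w hw) ?_
      ((hball w hw).1.1 hw0) ?_).differentiableAt
    · rw [hgf w hw]; exact (hball w hw).1.2.differentiableAt.hasDerivAt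
    · filter_upwards [hopen w hw _ (hBo.mem_nhds hw)]
      rintro _ ⟨x, hx, rfl⟩
      rw [hgf x hx]
  intro h0
  have h1 := hga.differentiableAt.hasDerivAt.comp z₀ hf.differentiableAt.hasDerivAt
  have h2 : HasDerivAt (g ∘ f) 1 z₀ := (hasDerivAt_id z₀).congr_of_eventuallyEq (by
    filter_upwards [hBo.mem_nhds hz₀] with w hw using hgf w hw)
  have := h1.unique h2
  rw [h0, mul_zero] at this
  exact zero_ne_one this

theorem sphereValue_of_analyticAt {f : ℂ → ℂ} {z : ℂ} (h : AnalyticAt ℂ f z) :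
    sphereValue f z = (f z : OnePoint ℂ) :=
  if_neg (not_lt.2 h.meromorphicOrderAt_nonneg)

theorem sphereValue_of_not_analyticAt {f : ℂ → ℂ} {z : ℂ} (hf : MeromorphicNFAt f z)
    (h : ¬ AnalyticAt ℂ f z) : sphereValue f z = OnePoint.infty := by
  refine if_pos (not_le.1 fun h' => h (hf.meromorphicOrderAt_nonneg_iff_analyticAt.1 h'))

theorem UnivalentOn.deriv_ne_zero {f : ℂ → ℂ} {V : Set ℂ} (h : UnivalentOn f V) {z₀ : ℂ}
    (hV : V ∈ 𝓝 z₀) (hf : AnalyticAt ℂ f z₀) : deriv f z₀ ≠ 0 := by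
  refine deriv_ne_zero_of_injOn_nhds hf (inter_mem hV hf.eventually_analyticAt) ?_
  intro z hz w hw hzw
  refine h.2 hz.1 hw.1 ?_
  rw [sphereValue_of_analyticAt hz.2, sphereValue_of_analyticAt hw.2, hzw]

/-- The normal form gives `f` the value 0 at a pole, and `0⁻¹ = 0`, so the pointwise inverse is
already the analytic reciprocal. It inherits injectivity because `f` has no genuine zeros near the
pole. -/
theorem UnivalentOn.inv_at_pole {f : ℂ → ℂ} {V : Set ℂ} (h : UnivalentOn f V) {z₀ : ℂ}
    (hV : V ∈ 𝓝 z₀) (hf : ¬ AnalyticAt ℂ f z₀) :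
    AnalyticAt ℂ f⁻¹ z₀ ∧ f z₀ = 0 ∧ deriv f⁻¹ z₀ ≠ 0 := by
  have hnf := h.1 (mem_of_mem_nhds hV)
  obtain ⟨hm, hlt, h0⟩ := (meromorphicNFAt_iff_analyticAt_or.1 hnf).resolve_left hf
  have hinv : AnalyticAt ℂ f⁻¹ z₀ := by
    refine hnf.inv.meromorphicOrderAt_nonneg_iff_analyticAt.1 ?_
    rw [meromorphicOrderAt_inv]
    cases hx : meromorphicOrderAt f z₀ with
    | top => simp [hx] at hlt
    | coe n =>
      rw [hx] at hlt
      have hn : n < 0 := by exact_mod_cast hlt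
      have : (0 : WithTop ℤ) ≤ ((-n : ℤ) : WithTop ℤ) := by exact_mod_cast (by omega)
      exact this
  refine ⟨hinv, h0, ?_⟩
  have hana : ∀ᶠ z in 𝓝[≠] z₀, AnalyticAt ℂ f z := hm.eventually_analyticAt
  have hne : ∀ᶠ z in 𝓝[≠] z₀, f z ≠ 0 :=
    (tendsto_cobounded_of_meromorphicOrderAt_neg hlt).eventually_ne_cobounded 0
  have hW := eventually_nhdsWithin_iff.1 (hana.and hne)
  refine deriv_ne_zero_of_injOn_nhds hinv (inter_mem hV hW) ?_
  intro z hz w hw hzw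
  have hzw' : f z = f w := inv_injective hzw
  by_cases hz0 : z = z₀
  · by_contra hzw0
    have hw0 : w ≠ z₀ := fun h => hzw0 (hz0.trans h.symm)
    rw [hz0, h0] at hzw'
    exact (hw.2 hw0).2 hzw'.symm
  by_cases hw0 : w = z₀
  · rw [hw0, h0] at hzw'
    exact absurd hzw' (hz.2 hz0).2
  refine h.2 hz.1 hw.1 ?_
  rw [sphereValue_of_analyticAt (hz.2 hz0).1, sphereValue_of_analyticAt (hw.2 hw0).1, hzw']

theorem AnalyticAt.preSchwarzian {f : ℂ → ℂ} {z : ℂ} (hf : AnalyticAt ℂ f z)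
    (h : deriv f z ≠ 0) : AnalyticAt ℂ (preSchwarzian f) z :=
  hf.deriv.deriv.div hf.deriv h

theorem AnalyticAt.schwarzian {f : ℂ → ℂ} {z : ℂ} (hf : AnalyticAt ℂ f z)
    (h : deriv f z ≠ 0) : AnalyticAt ℂ (schwarzian f) z :=
  (hf.preSchwarzian h).deriv.sub (analyticAt_const.mul ((hf.preSchwarzian h).pow 2))

theorem preSchwarzian_inv {y : ℂ → ℂ} {z : ℂ} (hy : AnalyticAt ℂ y z) (h0 : y z ≠ 0)
    (h1 : deriv y z ≠ 0) :
    _root_.preSchwarzian y⁻¹ z = _root_.preSchwarzian y z - 2 * (deriv y z / y z) := by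
  have hne : ∀ᶠ w in 𝓝 z, y w ≠ 0 := hy.continuousAt.eventually_ne h0
  have e1 : deriv y⁻¹ =ᶠ[𝓝 z] fun w => -deriv y w / y w ^ 2 := by
    filter_upwards [hne, hy.eventually_analyticAt] with w hw hwa
    exact (hwa.differentiableAt.hasDerivAt.inv hw).deriv
  have d1 := hy.differentiableAt.hasDerivAt
  have d2 := hy.deriv.differentiableAt.hasDerivAt
  have e2 : deriv (deriv y⁻¹) z
      = (-deriv (deriv y) z * y z ^ 2 - -deriv y z * (2 * y z * deriv y z)) / (y z ^ 2) ^ 2 := by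
    rw [e1.deriv_eq]
    have := d2.neg.div (d1.pow 2) (pow_ne_zero 2 h0)
    refine (this.congr_deriv ?_).deriv
    simp
  rw [_root_.preSchwarzian, e2, e1.self_of_nhds, _root_.preSchwarzian]
  field_simp
  ring

/-- Möbius invariance under inversion; it is the reason the Schwarzian stays regular at simple
poles. -/
theorem schwarzian_inv {y : ℂ → ℂ} {z : ℂ} (hy : AnalyticAt ℂ y z) (h0 : y z ≠ 0)
    (h1 : deriv y z ≠ 0) : _root_.schwarzian y⁻¹ z = _root_.schwarzian y z := by
  have e : _root_.preSchwarzian y⁻¹ =ᶠ[𝓝 z]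
      fun w => _root_.preSchwarzian y w - 2 * (deriv y w / y w) := by
    filter_upwards [hy.continuousAt.eventually_ne h0, hy.eventually_analyticAt,
      hy.deriv.continuousAt.eventually_ne h1] with w h2 h3 h4 using preSchwarzian_inv h3 h2 h4
  have d1 := hy.differentiableAt.hasDerivAt
  have d2 := hy.deriv.differentiableAt.hasDerivAt
  have d3 := (hy.preSchwarzian h1).differentiableAt.hasDerivAt
  have d4 : HasDerivAt (fun w => _root_.preSchwarzian y w - 2 * (deriv y w / y w)) _ z :=
    d3.sub ((d2.div d1 h0).const_mul 2)
  rw [_root_.schwarzian, e.deriv_eq, d4.deriv, e.self_of_nhds, _root_.schwarzian]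
  have : deriv (deriv y) z = _root_.preSchwarzian y z * deriv y z := by
    rw [_root_.preSchwarzian, div_mul_cancel₀ _ h1]
  rw [this]
  field_simp
  ring

/-- Local form of `f'' / f'` and of the Schwarzian derivative of a locally univalent function:
`m = 1` at poles and `m = 0` elsewhere. -/
structure HasLocalForm (f : ℂ → ℂ) (z₀ m : ℂ) (E S : ℂ → ℂ) : Prop where
  analyticAt_fst : AnalyticAt ℂ E z₀
  analyticAt_snd : AnalyticAt ℂ S z₀
  cases : m = 0 ∧ AnalyticAt ℂ f z₀ ∨ m = 1 ∧ ¬ AnalyticAt ℂ f z₀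
  eventually : ∀ᶠ z in 𝓝[≠] z₀, AnalyticAt ℂ f z ∧
    _root_.preSchwarzian f z = -2 * m / (z - z₀) + E z ∧ _root_.schwarzian f z = S z

/-- At a pole write `1/f = y = (z - z₀) e` with `e z₀ ≠ 0`. Then `f''/f' = y''/y' - 2 y'/y` has
polar part `-2 / (z - z₀)`. -/
theorem UnivalentOn.exists_hasLocalForm {f : ℂ → ℂ} {V : Set ℂ} (h : UnivalentOn f V) {z₀ : ℂ}
    (hV : V ∈ 𝓝 z₀) : ∃ m E S, HasLocalForm f z₀ m E S := by
  by_cases hf : AnalyticAt ℂ f z₀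
  · have h1 := h.deriv_ne_zero hV hf
    refine ⟨0, _, _, hf.preSchwarzian h1, hf.schwarzian h1, Or.inl ⟨rfl, hf⟩, ?_⟩
    filter_upwards [hf.eventually_analyticAt.filter_mono nhdsWithin_le_nhds] with z hz
    simp [hz]
  · obtain ⟨hy, h0, h1⟩ := h.inv_at_pole hV hf
    set y := f⁻¹ with hyf
    have hfy : f = y⁻¹ := (inv_inv f).symm
    have hy0 : y z₀ = 0 := by simp [hyf, h0]
    set e := dslope y z₀ with he
    have hea : AnalyticAt ℂ e z₀ := by
      obtain ⟨s, hs, hd⟩ : ∃ s ∈ 𝓝 z₀, DifferentiableOn ℂ y s :=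
        ⟨_, hy.eventually_analyticAt, fun z hz => hz.differentiableAt.differentiableWithinAt⟩
      exact ((Complex.differentiableOn_dslope hs).2 hd).analyticAt hs
    have he0 : e z₀ ≠ 0 := by rwa [he, dslope_same]
    have hye : ∀ z, y z = (z - z₀) * e z := fun z => by
      have := sub_smul_dslope y z₀ z
      rw [hy0, sub_zero, smul_eq_mul] at this
      exact this.symm
    refine ⟨1, fun z => _root_.preSchwarzian y z - 2 * (deriv e z / e z), _root_.schwarzian y,
      (hy.preSchwarzian h1).sub (analyticAt_const.mul (hea.deriv.div hea he0)),
      hy.schwarzian h1, Or.inr ⟨rfl, hf⟩, ?_⟩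
    rw [eventually_nhdsWithin_iff]
    filter_upwards [hy.eventually_analyticAt, hy.deriv.continuousAt.eventually_ne h1,
      hea.eventually_analyticAt, hea.continuousAt.eventually_ne he0] with z hza hz1 hea' he' hz
    have hz0 : z - z₀ ≠ 0 := sub_ne_zero.2 hz
    have hyz : y z ≠ 0 := by rw [hye]; exact mul_ne_zero hz0 he'
    have hdy : deriv y z = e z + (z - z₀) * deriv e z := by
      have h2 : y = fun z => (z - z₀) * e z := funext hye
      have h3 := ((hasDerivAt_id z).sub_const z₀).mul hea'.differentiableAt.hasDerivAt
      rw [h2]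
      refine (h3.congr_deriv ?_).deriv
      simp
    refine ⟨?_, ?_, ?_⟩
    · rw [hfy]; exact hza.inv hyz
    · rw [hfy, preSchwarzian_inv hza hyz hz1, hye z, hdy]
      field_simp
      ring
    · rw [hfy, schwarzian_inv hza hyz hz1]

/-! ### Constraints that the criterion imposes at poles. -/

theorem eq_zero_of_norm_le_norm_sub {Ψ : ℂ → ℂ} {z₀ : ℂ} (hc : ContinuousAt Ψ z₀)
    (h : ∀ᶠ z in 𝓝[≠] z₀, ‖Ψ z‖ ≤ ‖z - z₀‖) : Ψ z₀ = 0 := by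
  have h1 : Tendsto (fun z => ‖Ψ z‖) (𝓝[≠] z₀) (𝓝 ‖Ψ z₀‖) :=
    (hc.norm.tendsto).mono_left nhdsWithin_le_nhds
  have h2 : Tendsto (fun z => ‖z - z₀‖) (𝓝[≠] z₀) (𝓝 0) := by
    have : ContinuousAt (fun z => ‖z - z₀‖) z₀ := by fun_prop
    have := this.tendsto.mono_left (nhdsWithin_le_nhds (s := {z₀}ᶜ))
    simpa using this
  exact norm_le_zero_iff.1 (le_of_tendsto_of_tendsto h1 h2 h)

/-- The expression whose modulus is bounded in the univalence criterion. -/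
noncomputable def criterionExpr (A b c : ℂ → ℂ) (z : ℂ) : ℂ :=
  A z * (‖z‖ : ℂ) ^ 2 - ((‖z‖ : ℂ) ^ 2 - 1) * (z * b z)
    + ((‖z‖ : ℂ) ^ 2 - 1) ^ 2 * (z / starRingEnd ℂ z) * c z

theorem continuousAt_criterionExpr {A b c : ℂ → ℂ} {z : ℂ} (hz : z ≠ 0)
    (hA : ContinuousAt A z) (hb : ContinuousAt b z) (hc : ContinuousAt c z) :
    ContinuousAt (criterionExpr A b c) z := by
  have hn : ContinuousAt (fun z : ℂ => (‖z‖ : ℂ) ^ 2) z := by fun_prop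
  have hs : ContinuousAt (fun z : ℂ => starRingEnd ℂ z) z := Complex.continuous_conj.continuousAt
  exact ((hA.mul hn).sub ((hn.sub continuousAt_const).mul (continuousAt_id.mul hb))).add
    ((((hn.sub continuousAt_const).pow 2).mul
      (continuousAt_id.div hs ((map_ne_zero _).2 hz))).mul hc)

/-- The linear coefficient of the Riccati equation of the criterion. -/
noncomputable def riccatiLinear (f g h : ℂ → ℂ) (α : ℂ) (z : ℂ) : ℂ :=
  deriv h z / h z + ((1 - 2 * α) * _root_.preSchwarzian f z + 2 * α * _root_.preSchwarzian g z)

/-- The quadratic coefficient of the Riccati equation of the criterion. -/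
noncomputable def riccatiQuadratic (f g h : ℂ → ℂ) (α : ℂ) (z : ℂ) : ℂ :=
  α * h z * ((α - 1 / 2) * (_root_.preSchwarzian f z - _root_.preSchwarzian g z) ^ 2
    + (_root_.schwarzian f z - _root_.schwarzian g z))

theorem norm_pow_mul_le {w d : ℂ} {n : ℕ} (hn : n ≠ 0) (hw : ‖w‖ ≤ 1) (hd : ‖d‖ ≤ 1) :
    ‖d ^ n * w‖ ≤ ‖d‖ := by
  rw [norm_mul, norm_pow]
  calc ‖d‖ ^ n * ‖w‖ ≤ ‖d‖ ^ n * 1 := by gcongr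
    _ ≤ ‖d‖ := by rw [mul_one]; exact pow_le_of_le_one (norm_nonneg d) hd hn

/-- Where the criterion holds, only `f` has poles, and only if `α = 1 / 2`; only `g` has poles,
and only if `α = 0`. -/
theorem pole_conditions {f g h : ℂ → ℂ} {α z₀ m n : ℂ} {E G S R : ℂ → ℂ}
    (hz₀ : z₀ ∈ exteriorDisk) (hh : AnalyticAt ℂ h z₀) (hh0 : h z₀ ≠ 0)
    (hf : HasLocalForm f z₀ m E S) (hg : HasLocalForm g z₀ n G R)
    (hineq : ∀ᶠ z in 𝓝[≠] z₀, AnalyticAt ℂ f z → AnalyticAt ℂ g z →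
      ‖criterionExpr (fun z => (1 - h z) / h z) (riccatiLinear f g h α)
        (riccatiQuadratic f g h α) z‖ ≤ 1) :
    α * (α - 1 / 2) * (m - n) ^ 2 = 0 ∧ (1 - 2 * α) * m + 2 * α * n = 0 := by
  have hz0 : z₀ ≠ 0 := ne_zero_of_mem_exteriorDisk hz₀
  have hD : ((‖z₀‖ : ℂ) ^ 2 - 1) ≠ 0 := by
    have : 1 < ‖z₀‖ := hz₀
    rw [sub_ne_zero]
    norm_cast
    nlinarith
  have hconj : starRingEnd ℂ z₀ ≠ 0 := (map_ne_zero _).2 hz0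
  have cA : ContinuousAt (fun z => (1 - h z) / h z) z₀ :=
    (continuousAt_const.sub hh.continuousAt).div hh.continuousAt hh0
  have ch' : ContinuousAt (fun z => deriv h z / h z) z₀ :=
    hh.deriv.continuousAt.div hh.continuousAt hh0
  have cd : ContinuousAt (fun z : ℂ => z - z₀) z₀ := by fun_prop
  have cE := hf.analyticAt_fst.continuousAt
  have cG := hg.analyticAt_fst.continuousAt
  have cS := hf.analyticAt_snd.continuousAt
  have cR := hg.analyticAt_snd.continuousAt
  have ch := hh.continuousAt
  have hclose : ∀ᶠ z in 𝓝[≠] z₀, ‖z - z₀‖ ≤ 1 := by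
    filter_upwards [nhdsWithin_le_nhds (Metric.closedBall_mem_nhds z₀ one_pos)] with z hz
    simpa [dist_eq_norm] using hz
  -- Multiplying the bounded expression by `(z - z₀) ^ 2` and letting `z → z₀` isolates the
  -- double-pole coefficient.
  have first : α * (α - 1 / 2) * (m - n) ^ 2 = 0 := by
    have hc := continuousAt_criterionExpr (A := fun z => (z - z₀) ^ 2 * ((1 - h z) / h z))
      (b := fun z => (z - z₀) ^ 2 * (deriv h z / h z)
        + ((1 - 2 * α) * (-2 * m * (z - z₀) + (z - z₀) ^ 2 * E z)
          + 2 * α * (-2 * n * (z - z₀) + (z - z₀) ^ 2 * G z)))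
      (c := fun z => α * h z * ((α - 1 / 2) * (-2 * (m - n) + (z - z₀) * (E z - G z)) ^ 2
        + (z - z₀) ^ 2 * (S z - R z))) hz0 (by fun_prop) (by fun_prop) (by fun_prop)
    have := eq_zero_of_norm_le_norm_sub hc (by
      filter_upwards [hf.eventually, hg.eventually, hineq, hclose, self_mem_nhdsWithin]
        with z ⟨fa, fP, fS⟩ ⟨ga, gP, gS⟩ hz hz1 hzne
      have hz2 : z - z₀ ≠ 0 := sub_ne_zero.2 hzne
      refine le_trans (le_of_eq ?_) (norm_pow_mul_le two_ne_zero (hz fa ga) hz1)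
      congr 1
      simp only [criterionExpr, riccatiLinear, riccatiQuadratic, fP, gP, fS, gS]
      generalize (1 - h z) / h z = A
      generalize deriv h z / h z = B
      generalize z / starRingEnd ℂ z = B'
      field_simp
      ring)
    simp only [criterionExpr, sub_self, zero_mul, mul_zero, add_zero, zero_add, ne_eq,
      OfNat.ofNat_ne_zero, not_false_eq_true, zero_pow] at this
    have h2 : (((‖z₀‖ : ℂ) ^ 2 - 1) ^ 2 * (z₀ / starRingEnd ℂ z₀) * h z₀ * 4)
        * (α * (α - 1 / 2) * (m - n) ^ 2) = 0 := by
      rw [← this]; ring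
    exact (mul_eq_zero.1 h2).resolve_left (mul_ne_zero (mul_ne_zero (mul_ne_zero
      (pow_ne_zero 2 hD) (div_ne_zero hz0 hconj)) hh0) (by norm_num))
  refine ⟨first, ?_⟩
  -- The first power suffices to kill both the double and the simple pole of the quadratic
  -- coefficient, so multiplying by `z - z₀` leaves only the residue of the linear one.
  have first' : α * (α - 1 / 2) * (m - n) = 0 := by
    rcases mul_eq_zero.1 first with h1 | h1
    · rw [h1, zero_mul]
    · rw [pow_eq_zero_iff two_ne_zero] at h1; rw [h1, mul_zero]
  have hc := continuousAt_criterionExpr (A := fun z => (z - z₀) * ((1 - h z) / h z))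
    (b := fun z => (z - z₀) * (deriv h z / h z)
      + ((1 - 2 * α) * (-2 * m + (z - z₀) * E z) + 2 * α * (-2 * n + (z - z₀) * G z)))
    (c := fun z => (z - z₀) * (α * h z * ((α - 1 / 2) * (E z - G z) ^ 2 + (S z - R z))))
    hz0 (by fun_prop) (by fun_prop) (by fun_prop)
  have := eq_zero_of_norm_le_norm_sub hc (by
    filter_upwards [hf.eventually, hg.eventually, hineq, hclose, self_mem_nhdsWithin]
      with z ⟨fa, fP, fS⟩ ⟨ga, gP, gS⟩ hz hz1 hzne
    have hz2 : z - z₀ ≠ 0 := sub_ne_zero.2 hzne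
    refine le_trans (le_of_eq ?_) (norm_pow_mul_le one_ne_zero (hz fa ga) hz1)
    congr 1
    have e : riccatiQuadratic f g h α z
        = α * h z * ((α - 1 / 2) * (E z - G z) ^ 2 + (S z - R z)) := by
      have e1 : α * (α - 1 / 2) * (-2 * m / (z - z₀) + E z - (-2 * n / (z - z₀) + G z)) ^ 2
          = α * (α - 1 / 2) * (E z - G z) ^ 2 := by
        have : (-2 * m / (z - z₀) + E z - (-2 * n / (z - z₀) + G z)) ^ 2
            = (m - n) * (4 * (m - n) / (z - z₀) ^ 2 - 4 * (E z - G z) / (z - z₀))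
              + (E z - G z) ^ 2 := by
          field_simp
          ring
        rw [this, mul_add, ← mul_assoc, first', zero_mul, zero_add]
      simp only [riccatiQuadratic, fP, gP, fS, gS]
      linear_combination h z * e1
    rw [criterionExpr, criterionExpr, e]
    simp only [riccatiLinear, fP, gP]
    generalize (1 - h z) / h z = A
    generalize deriv h z / h z = B
    generalize z / starRingEnd ℂ z = B'
    field_simp)
  simp only [criterionExpr, sub_self, zero_mul, mul_zero, add_zero, zero_add, zero_sub] at this
  have h2 : (((‖z₀‖ : ℂ) ^ 2 - 1) * z₀ * 2) * ((1 - 2 * α) * m + 2 * α * n) = 0 := by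
    rw [← this]; ring
  exact (mul_eq_zero.1 h2).resolve_left (mul_ne_zero (mul_ne_zero hD hz0) two_ne_zero)

/-! ### Analytic extension of the coefficients over the poles. -/

theorem LocallyUnivalentOn.exists_univalentOn_nhds {f : ℂ → ℂ} {U : Set ℂ}
    (hf : LocallyUnivalentOn f U) {z : ℂ} (hz : z ∈ U) : ∃ V ∈ 𝓝 z, UnivalentOn f V := by
  obtain ⟨V, hVo, hzV, -, hV⟩ := hf z hz
  exact ⟨V, hVo.mem_nhds hzV, hV⟩

theorem LocallyUnivalentOn.deriv_ne_zero {f : ℂ → ℂ} {U : Set ℂ} (hf : LocallyUnivalentOn f U)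
    {z : ℂ} (hz : z ∈ U) (hfz : AnalyticAt ℂ f z) : deriv f z ≠ 0 := by
  obtain ⟨V, hV, hfV⟩ := hf.exists_univalentOn_nhds hz
  exact hfV.deriv_ne_zero hV hfz

theorem LocallyUnivalentOn.exists_hasLocalForm {f : ℂ → ℂ} {U : Set ℂ}
    (hf : LocallyUnivalentOn f U) {z : ℂ} (hz : z ∈ U) : ∃ m E S, HasLocalForm f z m E S := by
  obtain ⟨V, hV, hfV⟩ := hf.exists_univalentOn_nhds hz
  exact hfV.exists_hasLocalForm hV

theorem LocallyUnivalentOn.eventually_analyticAt {f : ℂ → ℂ} {U : Set ℂ}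
    (hf : LocallyUnivalentOn f U) {z : ℂ} (hz : z ∈ U) : ∀ᶠ w in 𝓝[≠] z, AnalyticAt ℂ f w := by
  obtain ⟨m, E, S, h⟩ := hf.exists_hasLocalForm hz
  exact h.eventually.mono fun w hw => hw.1

/-- The Schwarzian derivative of a locally univalent function extends analytically over the
poles. -/
theorem LocallyUnivalentOn.exists_schwarzian_extension {f : ℂ → ℂ} {U : Set ℂ}
    (hf : LocallyUnivalentOn f U) :
    ∃ S : ℂ → ℂ, AnalyticOnNhd ℂ S U ∧ ∀ z, AnalyticAt ℂ f z → S z = schwarzian f z := by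
  classical
  have hex : ∀ z : ℂ, ∃ S : ℂ → ℂ, z ∈ U → AnalyticAt ℂ S z ∧
      ∀ᶠ w in 𝓝[≠] z, AnalyticAt ℂ f w ∧ schwarzian f w = S w := by
    intro z
    by_cases hz : z ∈ U
    · obtain ⟨m, E, S, h⟩ := hf.exists_hasLocalForm hz
      exact ⟨S, fun _ => ⟨h.analyticAt_snd, h.eventually.mono fun w hw => ⟨hw.1, hw.2.2⟩⟩⟩
    · exact ⟨0, fun h => absurd h hz⟩
  choose S hS using hex
  refine ⟨fun z => if AnalyticAt ℂ f z then schwarzian f z else S z z, fun z hz => ?_,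
    fun z hz => if_pos hz⟩
  by_cases hfz : AnalyticAt ℂ f z
  · refine (hfz.schwarzian (hf.deriv_ne_zero hz hfz)).congr ?_
    filter_upwards [hfz.eventually_analyticAt] with w hw using (if_pos hw).symm
  · refine (hS z hz).1.congr ?_
    filter_upwards [eventually_nhdsWithin_iff.1 (hS z hz).2] with w hw
    by_cases hwz : w = z
    · rw [hwz, if_neg hfz]
    · rw [if_pos (hw hwz).1, (hw hwz).2]

section Coefficients

variable {f g h : ℂ → ℂ} {α : ℂ}

/-- If the criterion holds then `f` can have poles only for `α = 1 / 2`, and `g` only for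
`α = 0`. -/
theorem analyticOnNhd_of_criterion (hf : LocallyUnivalentOn f exteriorDisk)
    (hg : LocallyUnivalentOn g exteriorDisk) (hh : AnalyticOnNhd ℂ h exteriorDisk)
    (hh0 : ∀ z ∈ exteriorDisk, h z ≠ 0)
    (hineq : ∀ z ∈ exteriorDisk, AnalyticAt ℂ f z → AnalyticAt ℂ g z →
      ‖criterionExpr (fun z => (1 - h z) / h z) (riccatiLinear f g h α)
        (riccatiQuadratic f g h α) z‖ ≤ 1) :
    (α ≠ 1 / 2 → AnalyticOnNhd ℂ f exteriorDisk) ∧ (α ≠ 0 → AnalyticOnNhd ℂ g exteriorDisk) := by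
  have key : ∀ z ∈ exteriorDisk, (α ≠ 1 / 2 → AnalyticAt ℂ f z) ∧
      (α ≠ 0 → AnalyticAt ℂ g z) := by
    intro z hz
    obtain ⟨m, E, S, hm⟩ := hf.exists_hasLocalForm hz
    obtain ⟨n, G, R, hn⟩ := hg.exists_hasLocalForm hz
    obtain ⟨-, h2⟩ := pole_conditions (α := α) hz (hh z hz) (hh0 z hz) hm hn (by
      filter_upwards [nhdsWithin_le_nhds (isOpen_exteriorDisk.mem_nhds hz)] with w hw
        using hineq w hw)
    -- A pole of `g` alone forces `2α = 0`, a pole of `f` alone forces `1 - 2α = 0`, and a common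
    -- pole forces `1 = 0`.
    rcases hm.cases with ⟨rfl, hfz⟩ | ⟨rfl, hfz⟩ <;> rcases hn.cases with ⟨rfl, hgz⟩ | ⟨rfl, hgz⟩
    · exact ⟨fun _ => hfz, fun _ => hgz⟩
    · refine ⟨fun _ => hfz, fun h0 => absurd ?_ h0⟩
      linear_combination h2 / 2
    · refine ⟨fun h0 => absurd ?_ h0, fun _ => hgz⟩
      linear_combination - h2 / 2
    · exfalso
      have : (1 : ℂ) = 0 := by linear_combination h2
      exact one_ne_zero this
  exact ⟨fun h z hz => (key z hz).1 h, fun h z hz => (key z hz).2 h⟩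

theorem analyticOnNhd_riccatiLinear (hf : LocallyUnivalentOn f exteriorDisk)
    (hg : LocallyUnivalentOn g exteriorDisk) (hh : AnalyticOnNhd ℂ h exteriorDisk)
    (hh0 : ∀ z ∈ exteriorDisk, h z ≠ 0)
    (hfa : α ≠ 1 / 2 → AnalyticOnNhd ℂ f exteriorDisk)
    (hga : α ≠ 0 → AnalyticOnNhd ℂ g exteriorDisk) :
    AnalyticOnNhd ℂ (riccatiLinear f g h α) exteriorDisk := by
  intro z hz
  have h1 : AnalyticAt ℂ (fun z => (1 - 2 * α) * preSchwarzian f z) z := by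
    by_cases hα : α = 1 / 2
    · have : (1 - 2 * α) = 0 := by rw [hα]; norm_num
      simp only [this, zero_mul]
      exact analyticAt_const
    · exact analyticAt_const.mul
        ((hfa hα z hz).preSchwarzian (hf.deriv_ne_zero hz (hfa hα z hz)))
  have h2 : AnalyticAt ℂ (fun z => 2 * α * preSchwarzian g z) z := by
    by_cases hα : α = 0
    · simp only [hα, mul_zero, zero_mul]
      exact analyticAt_const
    · exact analyticAt_const.mul
        ((hga hα z hz).preSchwarzian (hg.deriv_ne_zero hz (hga hα z hz)))
  exact ((hh z hz).deriv.div (hh z hz) (hh0 z hz)).add (h1.add h2)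

/-- For `α = 0` everything vanishes. For `α = 1/2` the squared difference drops out and only the
Schwarzian of `f` has to be continued; otherwise `f` and `g` have no poles. -/
theorem exists_riccatiQuadratic_extension (hf : LocallyUnivalentOn f exteriorDisk)
    (hg : LocallyUnivalentOn g exteriorDisk) (hh : AnalyticOnNhd ℂ h exteriorDisk)
    (hfa : α ≠ 1 / 2 → AnalyticOnNhd ℂ f exteriorDisk)
    (hga : α ≠ 0 → AnalyticOnNhd ℂ g exteriorDisk) :
    ∃ c : ℂ → ℂ, AnalyticOnNhd ℂ c exteriorDisk ∧
      ∀ z, AnalyticAt ℂ f z → c z = riccatiQuadratic f g h α z := by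
  obtain ⟨S, hS, hSf⟩ := hf.exists_schwarzian_extension
  refine ⟨fun z => α * h z * ((α - 1 / 2) * (preSchwarzian f z - preSchwarzian g z) ^ 2
    + (S z - schwarzian g z)), fun z hz => ?_, fun z hz => by
      simp only [hSf z hz, riccatiQuadratic]⟩
  by_cases hα : α = 0
  · simp only [hα, zero_mul]
    exact analyticAt_const
  have hgz := hga hα z hz
  have hg' := hg.deriv_ne_zero hz hgz
  have h1 : AnalyticAt ℂ
      (fun z => (α - 1 / 2) * (preSchwarzian f z - preSchwarzian g z) ^ 2) z := by
    by_cases hα2 : α = 1 / 2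
    · simp only [hα2, sub_self, zero_mul]
      exact analyticAt_const
    · exact analyticAt_const.mul ((((hfa hα2 z hz).preSchwarzian
        (hf.deriv_ne_zero hz (hfa hα2 z hz))).sub (hgz.preSchwarzian hg')).pow 2)
  exact (analyticAt_const.mul (hh z hz)).mul (h1.add ((hS z hz).sub (hgz.schwarzian hg')))

/-- Poles are isolated, so the bound passes to them by continuity. -/
theorem norm_criterionExpr_extension_le {A b c c' : ℂ → ℂ}
    (hf : LocallyUnivalentOn f exteriorDisk) (hg : LocallyUnivalentOn g exteriorDisk)
    (hA : ContinuousOn A exteriorDisk) (hb : ContinuousOn b exteriorDisk)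
    (hc : ContinuousOn c exteriorDisk)
    (hcc : ∀ z, AnalyticAt ℂ f z → c z = c' z)
    (hineq : ∀ z ∈ exteriorDisk, AnalyticAt ℂ f z → AnalyticAt ℂ g z →
      ‖criterionExpr A b c' z‖ ≤ 1) :
    ∀ z ∈ exteriorDisk, ‖criterionExpr A b c z‖ ≤ 1 := by
  intro z hz
  have hU := isOpen_exteriorDisk.mem_nhds hz
  have hcont := continuousAt_criterionExpr (ne_zero_of_mem_exteriorDisk hz)
    (hA.continuousAt hU) (hb.continuousAt hU) (hc.continuousAt hU)
  refine le_of_tendsto (hcont.norm.tendsto.mono_left (nhdsWithin_le_nhds (s := {z}ᶜ))) ?_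
  filter_upwards [hf.eventually_analyticAt hz, hg.eventually_analyticAt hz,
    nhdsWithin_le_nhds hU] with w h1 h2 hw
  have := hineq w hw h1 h2
  rwa [criterionExpr, ← hcc w h1] at this

end Coefficients

/-! ### Quotient representations and their linear equation. -/

/-- The Wronskian `u' v - u v'`. -/
noncomputable def wronskian (u v : ℂ → ℂ) (z : ℂ) : ℂ := deriv u z * v z - u z * deriv v z

/-- A meromorphic function `f` is represented on `Ω` as a quotient `u / v` of holomorphic functions
with nonvanishing Wronskian. -/
structure IsQuotientOn (f u v : ℂ → ℂ) (Ω : Set ℂ) : Prop where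
  num : AnalyticOnNhd ℂ u Ω
  den : AnalyticOnNhd ℂ v Ω
  wronskian_ne : ∀ z ∈ Ω, wronskian u v z ≠ 0
  eq_mul : ∀ z ∈ Ω, AnalyticAt ℂ f z → v z ≠ 0 ∧ u =ᶠ[𝓝 z] fun w => f w * v w
  pole : ∀ z ∈ Ω, ¬ AnalyticAt ℂ f z → v z = 0 ∧ u z ≠ 0

theorem analyticAt_dslope {f : ℂ → ℂ} {z : ℂ} (hf : AnalyticAt ℂ f z) :
    AnalyticAt ℂ (dslope f z) z := by
  obtain ⟨s, hs, hd⟩ : ∃ s ∈ 𝓝 z, DifferentiableOn ℂ f s :=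
    ⟨_, hf.eventually_analyticAt, fun w hw => hw.differentiableAt.differentiableWithinAt⟩
  exact ((Complex.differentiableOn_dslope hs).2 hd).analyticAt hs

theorem wronskian_of_eq_mul {f u v : ℂ → ℂ} {z : ℂ} (hf : AnalyticAt ℂ f z)
    (hv : AnalyticAt ℂ v z) (h : u =ᶠ[𝓝 z] fun w => f w * v w) :
    wronskian u v z = deriv f z * v z ^ 2 := by
  rw [wronskian, h.deriv_eq, h.self_of_nhds,
    deriv_fun_mul hf.differentiableAt hv.differentiableAt]
  ring

/-- Poles are isolated and absent near infinity, so only finitely many lie in `‖z‖ ≥ r`; staying off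
the unit circle matters, as they may accumulate there. Take `v` to be the product of the factors `z
- a` over the poles `a`, and `u = f v`. The Wronskian is `f' v²` off the poles and `-u v'` at them,
nonzero because the poles are simple. -/
theorem exists_isQuotientOn {f : ℂ → ℂ} (hf : LocallyUnivalentOn f exteriorDisk) {R r : ℝ}
    (hR : ∀ z : ℂ, R < ‖z‖ → AnalyticAt ℂ f z) (hr : 1 < r) :
    ∃ u v, IsQuotientOn f u v {z | r < ‖z‖} := by
  classical
  set P : Set ℂ := {z | r ≤ ‖z‖ ∧ ¬ AnalyticAt ℂ f z} with hP
  have hfin : P.Finite := by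
    by_contra hinf
    have hK : IsCompact (Metric.closedBall (0 : ℂ) R ∩ {z | r ≤ ‖z‖}) :=
      (isCompact_closedBall 0 R).inter_right (isClosed_le continuous_const continuous_norm)
    obtain ⟨x, hx, hacc⟩ := Set.Infinite.exists_accPt_of_subset_isCompact hinf hK (fun z hz =>
      ⟨by
        rw [mem_closedBall_zero_iff]
        by_contra hlt
        exact hz.2 (hR z (not_le.1 hlt)), hz.1⟩)
    rw [accPt_iff_frequently_nhdsNE] at hacc
    refine hacc ?_
    have hxU : x ∈ exteriorDisk := lt_of_lt_of_le hr hx.2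
    filter_upwards [hf.eventually_analyticAt hxU] with w hw hwP using hwP.2 hw
  set v : ℂ → ℂ := fun z => ∏ a ∈ hfin.toFinset, (z - a) with hv
  have hva : ∀ z, AnalyticAt ℂ v z := fun z =>
    Finset.analyticAt_fun_prod _ fun a _ => analyticAt_id.sub analyticAt_const
  have hv0 : ∀ z, v z = 0 ↔ z ∈ P := fun z => by
    rw [hv]
    simp only [Finset.prod_eq_zero_iff, sub_eq_zero]
    constructor
    · rintro ⟨a, ha, rfl⟩; exact hfin.mem_toFinset.1 ha
    · intro hz; exact ⟨z, hfin.mem_toFinset.2 hz, rfl⟩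
  have hv' : ∀ a ∈ P, deriv v a ≠ 0 := by
    intro a ha
    have hsplit : v = fun z => (z - a) * ∏ b ∈ hfin.toFinset.erase a, (z - b) := by
      funext z
      exact (Finset.mul_prod_erase _ _ (hfin.mem_toFinset.2 ha)).symm
    have hw : AnalyticAt ℂ (fun z => ∏ b ∈ hfin.toFinset.erase a, (z - b)) a :=
      Finset.analyticAt_fun_prod _ fun b _ => analyticAt_id.sub analyticAt_const
    have hd : HasDerivAt (fun z => (z - a) * ∏ b ∈ hfin.toFinset.erase a, (z - b)) _ a :=
      ((hasDerivAt_id a).sub_const a).mul hw.differentiableAt.hasDerivAt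
    rw [hsplit, hd.deriv]
    simp only [id, sub_self, zero_mul, add_zero, one_mul]
    exact Finset.prod_ne_zero_iff.2 fun b hb => sub_ne_zero.2 (Finset.ne_of_mem_erase hb).symm
  -- The value at a pole is the limit of `v / f⁻¹`, a ratio of two functions with simple zeros.
  set u : ℂ → ℂ := fun z => if AnalyticAt ℂ f z then f z * v z else deriv v z / deriv f⁻¹ z with hu
  have hu1 : ∀ z, AnalyticAt ℂ f z → u =ᶠ[𝓝 z] fun w => f w * v w := fun z hz => by
    filter_upwards [hz.eventually_analyticAt] with w hw using if_pos hw
  have hpole : ∀ z, r < ‖z‖ → ¬ AnalyticAt ℂ f z → v z = 0 ∧ u z ≠ 0 ∧ AnalyticAt ℂ u z := by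
    intro z hz hfz
    have hzP : z ∈ P := ⟨hz.le, hfz⟩
    have hzU : z ∈ exteriorDisk := hr.trans hz
    obtain ⟨V, hV, hfV⟩ := hf.exists_univalentOn_nhds hzU
    obtain ⟨hy, hy0, hy1⟩ := hfV.inv_at_pole hV hfz
    refine ⟨(hv0 z).2 hzP, ?_, ?_⟩
    · rw [hu]; simp only [if_neg hfz]
      exact div_ne_zero (hv' z hzP) hy1
    · refine ((analyticAt_dslope (hva z)).div (analyticAt_dslope hy)
        (by rwa [dslope_same])).congr ?_
      filter_upwards [eventually_nhdsWithin_iff.1 (hf.eventually_analyticAt hzU)] with w hw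
      by_cases hwz : w = z
      · rw [hwz, Pi.div_apply, dslope_same, dslope_same, hu]; simp only [if_neg hfz]
      · rw [Pi.div_apply, dslope_of_ne _ hwz, dslope_of_ne _ hwz, slope_def_field,
          slope_def_field, (hv0 z).2 hzP, Pi.inv_apply, Pi.inv_apply, hy0, hu]
        simp only [if_pos (hw hwz)]
        have : w - z ≠ 0 := sub_ne_zero.2 hwz
        rw [inv_zero, sub_zero, sub_zero, div_div_div_cancel_right₀ this, div_inv_eq_mul, mul_comm]
  refine ⟨u, v, fun z hz => ?_, fun z _ => hva z, fun z hz => ?_, fun z hz hfz => ⟨?_, hu1 z hfz⟩,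
    fun z hz hfz => ⟨(hpole z hz hfz).1, (hpole z hz hfz).2.1⟩⟩
  · by_cases hfz : AnalyticAt ℂ f z
    · exact (hfz.mul (hva z)).congr (hu1 z hfz).symm
    · exact (hpole z hz hfz).2.2
  · by_cases hfz : AnalyticAt ℂ f z
    · rw [wronskian_of_eq_mul hfz (hva z) (hu1 z hfz)]
      exact mul_ne_zero (hf.deriv_ne_zero (hr.trans hz) hfz)
        (pow_ne_zero 2 fun h0 => ((hv0 z).1 h0).2 hfz)
    · obtain ⟨h1, h2, -⟩ := hpole z hz hfz
      rw [wronskian, h1, mul_zero, zero_sub]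
      exact neg_ne_zero.2 (mul_ne_zero h2 (hv' z ⟨le_of_lt hz, hfz⟩))
  · exact fun h0 => ((hv0 z).1 h0).2 hfz

theorem isQuotientOn_one {f : ℂ → ℂ} {Ω : Set ℂ} (hf : AnalyticOnNhd ℂ f Ω)
    (hd : ∀ z ∈ Ω, deriv f z ≠ 0) : IsQuotientOn f f (fun _ => 1) Ω where
  num := hf
  den := fun _ _ => analyticAt_const
  wronskian_ne z hz := by simpa [wronskian] using hd z hz
  eq_mul z _ _ := ⟨one_ne_zero, by simp⟩
  pole z hz h := absurd (hf z hz) h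

section Quotient

variable {f u v : ℂ → ℂ} {Ω : Set ℂ} {z : ℂ}

/-- The zeroth-order coefficient of the linear equation satisfied by `u` and `v`. -/
noncomputable def wronskianPotential (u v : ℂ → ℂ) (z : ℂ) : ℂ :=
  (deriv u z * deriv (deriv v) z - deriv (deriv u) z * deriv v z) / wronskian u v z

theorem hasDerivAt_wronskian (hu : AnalyticAt ℂ u z) (hv : AnalyticAt ℂ v z) :
    HasDerivAt (wronskian u v) (deriv (deriv u) z * v z - u z * deriv (deriv v) z) z := by
  have := (hu.deriv.differentiableAt.hasDerivAt.mul hv.differentiableAt.hasDerivAt).sub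
    (hu.differentiableAt.hasDerivAt.mul hv.deriv.differentiableAt.hasDerivAt)
  exact this.congr_deriv (by ring)

theorem AnalyticAt.wronskian (hu : AnalyticAt ℂ u z) (hv : AnalyticAt ℂ v z) :
    AnalyticAt ℂ (wronskian u v) z :=
  (hu.deriv.mul hv).sub (hu.mul hv.deriv)

/-- Cramer's rule: two functions with nonvanishing Wronskian solve a common linear second-order
equation. -/
theorem deriv_deriv_num (hu : AnalyticAt ℂ u z) (hv : AnalyticAt ℂ v z)
    (hw : _root_.wronskian u v z ≠ 0) :
    deriv (deriv u) z = logDeriv (_root_.wronskian u v) z * deriv u z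
      + wronskianPotential u v z * u z := by
  rw [logDeriv_apply, (hasDerivAt_wronskian hu hv).deriv, wronskianPotential, div_mul_eq_mul_div,
    div_mul_eq_mul_div, ← add_div, eq_div_iff hw, _root_.wronskian]
  ring

theorem deriv_deriv_den (hu : AnalyticAt ℂ u z) (hv : AnalyticAt ℂ v z)
    (hw : _root_.wronskian u v z ≠ 0) :
    deriv (deriv v) z = logDeriv (_root_.wronskian u v) z * deriv v z
      + wronskianPotential u v z * v z := by
  rw [logDeriv_apply, (hasDerivAt_wronskian hu hv).deriv, wronskianPotential, div_mul_eq_mul_div,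
    div_mul_eq_mul_div, ← add_div, eq_div_iff hw, _root_.wronskian]
  ring

theorem AnalyticAt.logDeriv_wronskian (hu : AnalyticAt ℂ u z) (hv : AnalyticAt ℂ v z)
    (hw : _root_.wronskian u v z ≠ 0) : AnalyticAt ℂ (logDeriv (_root_.wronskian u v)) z :=
  (hu.wronskian hv).deriv.div (hu.wronskian hv) hw

theorem AnalyticAt.wronskianPotential (hu : AnalyticAt ℂ u z) (hv : AnalyticAt ℂ v z)
    (hw : _root_.wronskian u v z ≠ 0) : AnalyticAt ℂ (wronskianPotential u v) z :=
  ((hu.deriv.mul hv.deriv.deriv).sub (hu.deriv.deriv.mul hv.deriv)).div (hu.wronskian hv) hw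

/-- This is the logarithmic derivative of `f' = ω / v²`, with `ω` the Wronskian. -/
theorem preSchwarzian_of_eq_mul (hf : AnalyticAt ℂ f z) (hf' : deriv f z ≠ 0)
    (hv : AnalyticAt ℂ v z) (hv0 : v z ≠ 0) (h : u =ᶠ[𝓝 z] fun w => f w * v w) :
    preSchwarzian f z = logDeriv (_root_.wronskian u v) z - 2 * (deriv v z / v z) := by
  have e : _root_.wronskian u v =ᶠ[𝓝 z] fun w => deriv f w * v w ^ 2 := by
    filter_upwards [hf.eventually_analyticAt, hv.eventually_analyticAt, h.eventuallyEq_nhds]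
      with w h1 h2 h3 using wronskian_of_eq_mul h1 h2 h3
  have hd : HasDerivAt (fun w => deriv f w * v w ^ 2) _ z :=
    hf.deriv.differentiableAt.hasDerivAt.mul (hv.differentiableAt.hasDerivAt.pow 2)
  rw [logDeriv_apply, e.deriv_eq, e.self_of_nhds, hd.deriv, preSchwarzian]
  field_simp
  ring

theorem schwarzian_of_eq_mul (hf : AnalyticAt ℂ f z) (hf' : deriv f z ≠ 0)
    (hv : AnalyticAt ℂ v z) (hv0 : v z ≠ 0) (h : u =ᶠ[𝓝 z] fun w => f w * v w) :
    schwarzian f z = deriv (logDeriv (_root_.wronskian u v)) z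
      - 1 / 2 * logDeriv (_root_.wronskian u v) z ^ 2 - 2 * wronskianPotential u v z := by
  have hu : AnalyticAt ℂ u z := (hf.mul hv).congr h.symm
  have hw : _root_.wronskian u v z ≠ 0 := by
    rw [wronskian_of_eq_mul hf hv h]; exact mul_ne_zero hf' (pow_ne_zero 2 hv0)
  have e : preSchwarzian f =ᶠ[𝓝 z]
      fun w => logDeriv (_root_.wronskian u v) w - 2 * (deriv v w / v w) := by
    filter_upwards [hf.eventually_analyticAt, hv.eventually_analyticAt, h.eventuallyEq_nhds,
      hf.deriv.continuousAt.eventually_ne hf', hv.continuousAt.eventually_ne hv0]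
      with w h1 h2 h3 h4 h5 using preSchwarzian_of_eq_mul h1 h4 h2 h5 h3
  have hd : HasDerivAt (fun w => logDeriv (_root_.wronskian u v) w - 2 * (deriv v w / v w)) _ z :=
    (hu.logDeriv_wronskian hv hw).differentiableAt.hasDerivAt.sub
      ((hv.deriv.differentiableAt.hasDerivAt.div hv.differentiableAt.hasDerivAt hv0).const_mul 2)
  rw [schwarzian, e.deriv_eq, hd.deriv, e.self_of_nhds, deriv_deriv_den hu hv hw]
  field_simp
  ring

end Quotient

/-! ### The Riccati coefficients in terms of `u` and `v`. -/

section RiccatiCoefficients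

variable {f g h u v : ℂ → ℂ} {α : ℂ} {Ω : Set ℂ}

/-- The function `α (ω' / ω - g'' / g')`, where `ω` is the Wronskian. -/
noncomputable def riccatiShift (g u v : ℂ → ℂ) (α : ℂ) (z : ℂ) : ℂ :=
  α * (logDeriv (wronskian u v) z - preSchwarzian g z)

theorem analyticAt_riccatiShift {z : ℂ} (hu : AnalyticAt ℂ u z) (hv : AnalyticAt ℂ v z)
    (hw : wronskian u v z ≠ 0) (hg : α ≠ 0 → AnalyticAt ℂ g z ∧ deriv g z ≠ 0) :
    AnalyticAt ℂ (riccatiShift g u v α) z := by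
  by_cases hα : α = 0
  · have : riccatiShift g u v α = fun _ => 0 := by funext w; simp [riccatiShift, hα]
    rw [this]
    exact analyticAt_const
  · exact analyticAt_const.mul ((hu.logDeriv_wronskian hv hw).sub
      ((hg hα).1.preSchwarzian (hg hα).2))

/-- Either `α = 1/2`, and `f''/f'` has coefficient 0, or `v = 1`, and the Wronskian is `f'`. -/
theorem riccatiLinear_eq {z : ℂ} (hv : α = 1 / 2 ∨ u = f ∧ v = fun _ => 1) :
    riccatiLinear f g h α z = deriv h z / h z + logDeriv (wronskian u v) z
      - 2 * riccatiShift g u v α z := by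
  rw [riccatiLinear, riccatiShift]
  rcases hv with rfl | ⟨rfl, rfl⟩
  · ring
  · have : wronskian u (fun _ => 1) = deriv u := by funext w; simp [wronskian]
    rw [this, logDeriv_apply, preSchwarzian]
    ring

theorem riccatiQuadratic_eq {z : ℂ} (hv : α = 1 / 2 ∨ u = f ∧ v = fun _ => 1)
    (hf : AnalyticAt ℂ f z) (hf' : deriv f z ≠ 0) (hg : AnalyticAt ℂ g z) (hg' : deriv g z ≠ 0)
    (hva : AnalyticAt ℂ v z) (hv0 : v z ≠ 0) (huv : u =ᶠ[𝓝 z] fun w => f w * v w) :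
    riccatiQuadratic f g h α z = h z * (deriv (riccatiShift g u v α) z
      + riccatiShift g u v α z ^ 2 - riccatiShift g u v α z * logDeriv (wronskian u v) z
      - wronskianPotential u v z) := by
  have hu : AnalyticAt ℂ u z := (hf.mul hva).congr huv.symm
  have hw : wronskian u v z ≠ 0 := by
    rw [wronskian_of_eq_mul hf hva huv]; exact mul_ne_zero hf' (pow_ne_zero 2 hv0)
  have hd : HasDerivAt (riccatiShift g u v α) _ z :=
    ((hu.logDeriv_wronskian hva hw).differentiableAt.hasDerivAt.sub
      (hg.preSchwarzian hg').differentiableAt.hasDerivAt).const_mul α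
  rw [hd.deriv, riccatiQuadratic, schwarzian_of_eq_mul hf hf' hva hv0 huv, riccatiShift]
  -- The two sides differ by this multiple of the potential, which vanishes in either case since `v
  -- = 1` has zero potential.
  have h1 : (1 - 2 * α) * wronskianPotential u v z = 0 := by
    rcases hv with rfl | ⟨rfl, rfl⟩
    · ring
    · simp [wronskianPotential]
  have h2 : (α - 1 / 2) * (preSchwarzian f z - preSchwarzian g z) ^ 2
      = (α - 1 / 2) * (logDeriv (wronskian u v) z - preSchwarzian g z) ^ 2 := by
    rcases hv with rfl | ⟨rfl, rfl⟩
    · ring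
    · rw [preSchwarzian_of_eq_mul hf hf' hva hv0 huv]
      simp
  rw [h2, schwarzian]
  linear_combination h z * h1

/-- The first integral in terms of `f`. -/
theorem riccatiLift_num {z x : ℂ} (hv : α = 1 / 2 ∨ u = f ∧ v = fun _ => 1)
    (hf : AnalyticAt ℂ f z) (hf' : deriv f z ≠ 0)
    (hva : AnalyticAt ℂ v z) (hv0 : v z ≠ 0) (huv : u =ᶠ[𝓝 z] fun w => f w * v w) :
    riccatiLift h (riccatiShift g u v α) u z x = v z *
      (f z * (1 - x * h z * (α * (preSchwarzian f z - preSchwarzian g z)))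
        + x * h z * deriv f z) := by
  have e := preSchwarzian_of_eq_mul hf hf' hva hv0 huv
  have hd : HasDerivAt (fun w => f w * v w) _ z :=
    hf.differentiableAt.hasDerivAt.mul hva.differentiableAt.hasDerivAt
  -- Replacing `ω'/ω` by `f''/f' + 2 v'/v` leaves exactly this discrepancy.
  have h1 : (1 - 2 * α) * deriv v z = 0 := by
    rcases hv with rfl | ⟨rfl, rfl⟩
    · ring
    · simp
  rw [riccatiLift, riccatiShift, huv.deriv_eq, hd.deriv, huv.self_of_nhds, e]
  field_simp
  linear_combination x * h z * f z * h1

theorem riccatiLift_den {z x : ℂ} (hv : α = 1 / 2 ∨ u = f ∧ v = fun _ => 1)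
    (hf : AnalyticAt ℂ f z) (hf' : deriv f z ≠ 0)
    (hva : AnalyticAt ℂ v z) (hv0 : v z ≠ 0) (huv : u =ᶠ[𝓝 z] fun w => f w * v w) :
    riccatiLift h (riccatiShift g u v α) v z x = v z *
      (1 - x * h z * (α * (preSchwarzian f z - preSchwarzian g z))) := by
  have e := preSchwarzian_of_eq_mul hf hf' hva hv0 huv
  have h1 : (1 - 2 * α) * deriv v z = 0 := by
    rcases hv with rfl | ⟨rfl, rfl⟩
    · ring
    · simp
  rw [riccatiLift, riccatiShift, e]
  field_simp
  linear_combination x * h z * h1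

end RiccatiCoefficients

/-! ### Expansions at infinity. -/

theorem eventually_cobounded_iff {p : ℂ → Prop} :
    (∀ᶠ z in Bornology.cobounded ℂ, p z) ↔ ∃ R : ℝ, ∀ z, R < ‖z‖ → p z := by
  rw [← comap_norm_atTop, eventually_comap, eventually_atTop]
  constructor
  · rintro ⟨R, hR⟩
    exact ⟨R, fun z hz => hR _ hz.le z rfl⟩
  · rintro ⟨R, hR⟩
    exact ⟨R + 1, fun b hb z hz => hR z (by linarith)⟩

theorem eventually_cobounded_nhds {p : ℂ → Prop} (h : ∀ᶠ z in Bornology.cobounded ℂ, p z) :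
    ∀ᶠ z in Bornology.cobounded ℂ, ∀ᶠ w in 𝓝 z, p w := by
  obtain ⟨R, hR⟩ := eventually_cobounded_iff.1 h
  exact eventually_cobounded_iff.2 ⟨R, fun z hz =>
    (continuous_norm.continuousAt.eventually (lt_mem_nhds hz)).mono fun w hw => hR w hw⟩

theorem tendsto_inv_cobounded_nhds : Tendsto (fun z : ℂ => z⁻¹) (Bornology.cobounded ℂ) (𝓝 0) :=
  tendsto_inv₀_cobounded

theorem eventually_cobounded_ne_zero : ∀ᶠ z : ℂ in Bornology.cobounded ℂ, z ≠ 0 :=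
  eventually_cobounded_iff.2 ⟨0, fun _ hz => norm_pos_iff.1 hz⟩

theorem eventually_cobounded_inv {p : ℂ → Prop} (h : ∀ᶠ η in 𝓝 0, p η) :
    ∀ᶠ z in Bornology.cobounded ℂ, p z⁻¹ := tendsto_inv_cobounded_nhds.eventually h

/-- The sum of a power series in `1 / ζ` is analytic in `1 / ζ` at infinity. -/
theorem exists_analyticAt_of_hasSum_div_pow {c : ℕ → ℂ} {F : ℂ → ℂ} {R : ℝ}
    (h : ∀ ζ : ℂ, R < ‖ζ‖ → HasSum (fun n : ℕ => c n / ζ ^ n) (F ζ)) :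
    ∃ φ : ℂ → ℂ, AnalyticAt ℂ φ 0 ∧ φ 0 = c 0 ∧ ∀ᶠ z in Bornology.cobounded ℂ, F z = φ z⁻¹ := by
  set ρ : ℝ := max R 0 + 1 with hρ
  have hρ0 : 0 < ρ := by positivity
  have hρR : R < ρ := (le_max_left R 0).trans_lt (lt_add_one _)
  have hterm : ∀ (ζ : ℂ) (n : ℕ), c n / ζ ^ n = c n * (ζ⁻¹) ^ n := fun ζ n => by
    rw [inv_pow, div_eq_mul_inv]
  have hsum := h ρ (by rwa [Complex.norm_real, Real.norm_of_nonneg hρ0.le])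
  set p := FormalMultilinearSeries.ofScalars ℂ c with hp
  have hrad : ENNReal.ofReal ρ⁻¹ ≤ p.radius := by
    have h1 : Tendsto (fun n => ‖p n‖ * ((⟨ρ⁻¹, by positivity⟩ : NNReal) : ℝ) ^ n) atTop (𝓝 0) := by
      have := hsum.summable.tendsto_atTop_zero.norm
      rw [norm_zero] at this
      refine this.congr fun n => ?_
      rw [hp, FormalMultilinearSeries.ofScalars_norm, hterm, norm_mul, norm_pow, norm_inv,
        Complex.norm_real, Real.norm_of_nonneg hρ0.le]
    have h2 := p.le_radius_of_tendsto h1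
    refine le_trans (le_of_eq ?_) h2
    rw [ENNReal.ofReal]
    congr 1
    exact Real.toNNReal_of_nonneg (by positivity)
  have hpos : 0 < p.radius := lt_of_lt_of_le (ENNReal.ofReal_pos.2 (by positivity)) hrad
  have hps := p.hasFPowerSeriesOnBall hpos
  refine ⟨p.sum, hps.analyticAt, ?_, ?_⟩
  · rw [hp]
    change FormalMultilinearSeries.ofScalarsSum c (0 : ℂ) = c 0
    simp [FormalMultilinearSeries.ofScalarsSum_zero]
  · refine eventually_cobounded_iff.2 ⟨R, fun z hz => ?_⟩
    have h3 : p.sum z⁻¹ = ∑' n, c n * (z⁻¹) ^ n := by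
      rw [FormalMultilinearSeries.sum]
      refine tsum_congr fun n => ?_
      rw [hp, FormalMultilinearSeries.ofScalars_apply_eq, smul_eq_mul]
    rw [h3, ← (h z hz).tsum_eq]
    exact tsum_congr fun n => hterm z n

/-- The behaviour at infinity of a function of the class `Σ`, in the coordinate `1 / z`. -/
structure HasExpansion (f : ℂ → ℂ) (b : ℂ) (φ : ℂ → ℂ) : Prop where
  ne_zero : b ≠ 0
  analyticAt : AnalyticAt ℂ φ 0
  eventually_eq : ∀ᶠ z in Bornology.cobounded ℂ, f z = b * z + φ z⁻¹

theorem ClassSigma.exists_hasExpansion {f : ℂ → ℂ} (hf : ClassSigma f) :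
    ∃ b φ, HasExpansion f b φ := by
  obtain ⟨-, b, c, R, hb, hsum⟩ := hf
  obtain ⟨φ, hφ, -, he⟩ := exists_analyticAt_of_hasSum_div_pow (F := fun z => f z - b * z) hsum
  exact ⟨b, φ, hb, hφ, he.mono fun z hz => by linear_combination hz⟩

/-- The function `ψ` with `f'' / f' = z⁻³ ψ (1 / z)`. -/
noncomputable def expansionPreSchwarzian (b : ℂ) (φ : ℂ → ℂ) (η : ℂ) : ℂ :=
  (2 * deriv φ η + η * deriv (deriv φ) η) / (b - η ^ 2 * deriv φ η)

theorem HasDerivAt.comp_inv {φ : ℂ → ℂ} {φ' z : ℂ} (hφ : HasDerivAt φ φ' z⁻¹) (hz : z ≠ 0) :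
    HasDerivAt (fun z => φ z⁻¹) (-(z⁻¹ ^ 2 * φ')) z := by
  refine (hφ.comp z (hasDerivAt_inv hz)).congr_deriv ?_
  rw [inv_pow]; ring

namespace HasExpansion

variable {f : ℂ → ℂ} {b : ℂ} {φ : ℂ → ℂ}

theorem analyticAt_expansionPreSchwarzian (h : HasExpansion f b φ) :
    AnalyticAt ℂ (expansionPreSchwarzian b φ) 0 := by
  have h1 := h.analyticAt.deriv
  have h2 := h1.deriv
  refine ((analyticAt_const.mul h1).add (analyticAt_id.mul h2)).div
    (analyticAt_const.sub ((analyticAt_id.pow 2).mul h1)) ?_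
  simpa using h.ne_zero

theorem eventually_analyticAt (h : HasExpansion f b φ) :
    ∀ᶠ z in Bornology.cobounded ℂ, AnalyticAt ℂ f z := by
  filter_upwards [eventually_cobounded_nhds h.eventually_eq, eventually_cobounded_ne_zero,
    eventually_cobounded_inv h.analyticAt.eventually_analyticAt] with z hz hz0 hφ
  have h1 : AnalyticAt ℂ (fun z : ℂ => z⁻¹) z := analyticAt_inv hz0
  exact ((analyticAt_const.mul analyticAt_id).add (hφ.fun_comp h1)).congr
    (EventuallyEq.symm hz)

theorem eventually_deriv (h : HasExpansion f b φ) :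
    ∀ᶠ z in Bornology.cobounded ℂ, deriv f z = b - z⁻¹ ^ 2 * deriv φ z⁻¹ := by
  filter_upwards [eventually_cobounded_nhds h.eventually_eq, eventually_cobounded_ne_zero,
    eventually_cobounded_inv h.analyticAt.eventually_analyticAt] with z hz hz0 hφ
  have hz' : f =ᶠ[𝓝 z] fun z => b * z + φ z⁻¹ := hz
  have hd : HasDerivAt (fun z => b * z + φ z⁻¹) _ z :=
    ((hasDerivAt_id z).const_mul b).add (hφ.differentiableAt.hasDerivAt.comp_inv hz0)
  rw [hz'.deriv_eq, hd.deriv]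
  ring

theorem eventually_preSchwarzian (h : HasExpansion f b φ) :
    ∀ᶠ z in Bornology.cobounded ℂ,
      preSchwarzian f z = z⁻¹ ^ 3 * expansionPreSchwarzian b φ z⁻¹ := by
  filter_upwards [eventually_cobounded_nhds h.eventually_deriv, eventually_cobounded_ne_zero,
    eventually_cobounded_inv h.analyticAt.eventually_analyticAt] with z hz hz0 hφ
  have hz' : deriv f =ᶠ[𝓝 z] fun z => b - z⁻¹ ^ 2 * deriv φ z⁻¹ := hz
  have hd : HasDerivAt (fun z => b - z⁻¹ ^ 2 * deriv φ z⁻¹) _ z :=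
    (((hasDerivAt_inv hz0).pow 2).mul
      (hφ.deriv.differentiableAt.hasDerivAt.comp_inv hz0)).const_sub b
  rw [preSchwarzian, hz'.deriv_eq, hz'.self_of_nhds, hd.deriv, expansionPreSchwarzian,
    ← mul_div_assoc]
  congr 1
  simp only [Pi.pow_apply, Nat.cast_ofNat, Nat.reduceSub, pow_one]
  field_simp
  ring

theorem tendsto_mul_preSchwarzian (h : HasExpansion f b φ) :
    Tendsto (fun z => z * preSchwarzian f z) (Bornology.cobounded ℂ) (𝓝 0) := by
  have hc : ContinuousAt (fun η => η ^ 2 * expansionPreSchwarzian b φ η) 0 :=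
    (continuousAt_id.pow 2).mul h.analyticAt_expansionPreSchwarzian.continuousAt
  have := hc.tendsto.comp tendsto_inv_cobounded_nhds
  simp only [ne_eq, OfNat.ofNat_ne_zero, not_false_eq_true, zero_pow, zero_mul] at this
  refine this.congr' ?_
  filter_upwards [h.eventually_preSchwarzian, eventually_cobounded_ne_zero] with z hz hz0
  rw [hz, Function.comp_apply]
  field_simp

theorem tendsto_sq_mul_schwarzian (h : HasExpansion f b φ) :
    Tendsto (fun z => z ^ 2 * schwarzian f z) (Bornology.cobounded ℂ) (𝓝 0) := by
  set ψ := expansionPreSchwarzian b φ with hψ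
  have ha : AnalyticAt ℂ ψ 0 := h.analyticAt_expansionPreSchwarzian
  have hc : ContinuousAt (fun η => -3 * (η ^ 2 * ψ η) - η ^ 3 * deriv ψ η
      - 1 / 2 * η ^ 4 * ψ η ^ 2) 0 :=
    ((continuousAt_const.mul ((continuousAt_id.pow 2).mul ha.continuousAt)).sub
      ((continuousAt_id.pow 3).mul ha.deriv.continuousAt)).sub
      ((continuousAt_const.mul (continuousAt_id.pow 4)).mul (ha.continuousAt.pow 2))
  have := hc.tendsto.comp tendsto_inv_cobounded_nhds
  simp only [ne_eq, OfNat.ofNat_ne_zero, not_false_eq_true, zero_pow, zero_mul, mul_zero,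
    sub_zero] at this
  refine this.congr' ?_
  filter_upwards [eventually_cobounded_nhds h.eventually_preSchwarzian,
    eventually_cobounded_ne_zero, eventually_cobounded_inv ha.eventually_analyticAt]
    with z hz hz0 hψz
  have hz' : preSchwarzian f =ᶠ[𝓝 z] fun z => z⁻¹ ^ 3 * ψ z⁻¹ := hz
  have hd : HasDerivAt (fun z => z⁻¹ ^ 3 * ψ z⁻¹) _ z :=
    ((hasDerivAt_inv hz0).pow 3).mul (hψz.differentiableAt.hasDerivAt.comp_inv hz0)
  rw [schwarzian, hz'.deriv_eq, hz'.self_of_nhds, hd.deriv, Function.comp_apply]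
  simp only [Pi.pow_apply, Nat.cast_ofNat, Nat.reduceSub]
  field_simp
  ring

end HasExpansion

section Limits

variable {h H : ℂ → ℂ}

theorem tendsto_one_sub_div (hH : AnalyticAt ℂ H 0) (hH0 : H 0 = 1)
    (he : ∀ᶠ z in Bornology.cobounded ℂ, h z = H z⁻¹) :
    Tendsto (fun z => (1 - h z) / h z) (Bornology.cobounded ℂ) (𝓝 0) := by
  have hc : ContinuousAt (fun η => (1 - H η) / H η) 0 :=
    (continuousAt_const.sub hH.continuousAt).div hH.continuousAt (by rw [hH0]; exact one_ne_zero)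
  have := hc.tendsto.comp tendsto_inv_cobounded_nhds
  rw [hH0, sub_self, zero_div] at this
  exact this.congr' (he.mono fun z hz => by simp only [hz, Function.comp_apply])

theorem tendsto_mul_deriv_div (hH : AnalyticAt ℂ H 0) (hH0 : H 0 = 1)
    (he : ∀ᶠ z in Bornology.cobounded ℂ, h z = H z⁻¹) :
    Tendsto (fun z => z * (deriv h z / h z)) (Bornology.cobounded ℂ) (𝓝 0) := by
  have hc : ContinuousAt (fun η => -(η * (deriv H η / H η))) 0 :=
    (continuousAt_id.mul (hH.deriv.continuousAt.div hH.continuousAt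
      (by rw [hH0]; exact one_ne_zero))).neg
  have := hc.tendsto.comp tendsto_inv_cobounded_nhds
  rw [zero_mul, neg_zero] at this
  refine this.congr' ?_
  filter_upwards [eventually_cobounded_nhds he, eventually_cobounded_ne_zero,
    eventually_cobounded_inv hH.eventually_analyticAt] with z hz hz0 hHz
  have hz' : h =ᶠ[𝓝 z] fun z => H z⁻¹ := hz
  rw [hz'.deriv_eq, hz'.self_of_nhds, (hHz.differentiableAt.hasDerivAt.comp_inv hz0).deriv,
    Function.comp_apply]
  field_simp

end Limits

/-! ### Separation of points near infinity. -/

section AsymptoticInjectivity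

variable {f g h H : ℂ → ℂ} {α b b' : ℂ} {φ φ' : ℂ → ℂ}

/-- The denominator of the first integral near infinity. -/
noncomputable def expansionDen (H : ℂ → ℂ) (α : ℂ) (ψ : ℂ → ℂ) (p : ℂ × ℂ) : ℂ :=
  1 + α * p.2 * H p.1 * p.1 ^ 2 * ψ p.1

/-- The first integral near infinity, up to its principal part. -/
noncomputable def expansionTail (H : ℂ → ℂ) (α b : ℂ) (φ ψ : ℂ → ℂ) (p : ℂ × ℂ) : ℂ :=
  φ p.1 - p.2 * (b * dslope H 0 p.1 - p.1 * deriv φ p.1 * H p.1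
    - b * α * p.2 * H p.1 * p.1 * ψ p.1) / expansionDen H α ψ p

theorem contDiffAt_comp_fst {F : ℂ → ℂ} (hF : AnalyticAt ℂ F 0) (s : ℂ) :
    ContDiffAt ℂ 1 (fun p : ℂ × ℂ => F p.1) (0, s) := by
  have h1 : ContDiffAt ℂ 1 F ((0, s) : ℂ × ℂ).1 := hF.contDiffAt
  exact h1.comp (0, s) contDiffAt_fst

theorem contDiffAt_expansionDen {ψ : ℂ → ℂ} (hH : AnalyticAt ℂ H 0) (hψ : AnalyticAt ℂ ψ 0)
    (s : ℂ) : ContDiffAt ℂ 1 (expansionDen H α ψ) (0, s) :=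
  contDiffAt_const.add ((((contDiffAt_const.mul contDiffAt_snd).mul
    (contDiffAt_comp_fst hH s)).mul (contDiffAt_fst.pow 2)).mul (contDiffAt_comp_fst hψ s))

theorem expansionDen_zero (ψ : ℂ → ℂ) (s : ℂ) : expansionDen H α ψ (0, s) = 1 := by
  simp [expansionDen]

theorem contDiffAt_expansionTail {ψ : ℂ → ℂ} (hH : AnalyticAt ℂ H 0) (hφ : AnalyticAt ℂ φ 0)
    (hψ : AnalyticAt ℂ ψ 0) (s : ℂ) : ContDiffAt ℂ 1 (expansionTail H α b φ ψ) (0, s) := by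
  have cH := contDiffAt_comp_fst hH s
  have cχ := contDiffAt_comp_fst (analyticAt_dslope hH) s
  have cφ := contDiffAt_comp_fst hφ s
  have cφ' := contDiffAt_comp_fst hφ.deriv s
  have cψ := contDiffAt_comp_fst hψ s
  refine cφ.sub (ContDiffAt.div (contDiffAt_snd.mul (((contDiffAt_const.mul cχ).sub
    ((contDiffAt_fst.mul cφ').mul cH)).sub
    ((((contDiffAt_const.mul contDiffAt_snd).mul cH).mul contDiffAt_fst).mul cψ)))
    (contDiffAt_expansionDen hH hψ s) ?_)
  rw [expansionDen_zero]
  exact one_ne_zero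

/-- Near infinity the first integral separates points. -/
theorem exists_separation (hf : HasExpansion f b φ) (hg : HasExpansion g b' φ')
    (hH : AnalyticAt ℂ H 0) (hH0 : H 0 = 1)
    (he : ∀ᶠ z in Bornology.cobounded ℂ, h z = H z⁻¹) :
    ∃ ε : ℝ, 0 < ε ∧ ∀ T : ℝ, 0 ≤ T → Real.exp (-T) < ε → ∀ z₁ z₂ : ℂ, z₁ ≠ 0 → z₂ ≠ 0 →
      z₁ ≠ z₂ → ‖z₁⁻¹‖ < ε * Real.exp (-T) → ‖z₂⁻¹‖ < ε * Real.exp (-T) →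
      (f z₁ * (1 - ((Real.exp (-T) : ℂ) ^ 2 - 1) * z₁ * h z₁ *
            (α * (preSchwarzian f z₁ - preSchwarzian g z₁)))
          + ((Real.exp (-T) : ℂ) ^ 2 - 1) * z₁ * h z₁ * deriv f z₁)
        * (1 - ((Real.exp (-T) : ℂ) ^ 2 - 1) * z₂ * h z₂ *
            (α * (preSchwarzian f z₂ - preSchwarzian g z₂)))
      ≠ (f z₂ * (1 - ((Real.exp (-T) : ℂ) ^ 2 - 1) * z₂ * h z₂ *
            (α * (preSchwarzian f z₂ - preSchwarzian g z₂)))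
          + ((Real.exp (-T) : ℂ) ^ 2 - 1) * z₂ * h z₂ * deriv f z₂)
        * (1 - ((Real.exp (-T) : ℂ) ^ 2 - 1) * z₁ * h z₁ *
            (α * (preSchwarzian f z₁ - preSchwarzian g z₁))) := by
  set ψ : ℂ → ℂ := fun η => expansionPreSchwarzian b φ η - expansionPreSchwarzian b' φ' η with hψd
  have hψ : AnalyticAt ℂ ψ 0 :=
    hf.analyticAt_expansionPreSchwarzian.sub hg.analyticAt_expansionPreSchwarzian
  -- The second variable is `1 - s ^ 2` with `s` small, so the base point is `(0, 1)`.
  obtain ⟨K, N, hN, hlip⟩ := (contDiffAt_expansionTail (α := α) (b := b) hH hf.analyticAt hψ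
    1).exists_lipschitzOnWith
  have hden : ∀ᶠ p in 𝓝 ((0, 1) : ℂ × ℂ), expansionDen H α ψ p ≠ 0 :=
    (contDiffAt_expansionDen hH hψ 1).continuousAt.eventually_ne
      (by rw [expansionDen_zero]; exact one_ne_zero)
  obtain ⟨δ, hδ, hball⟩ := Metric.mem_nhds_iff.1 (inter_mem hN hden)
  obtain ⟨R, hR⟩ := eventually_cobounded_iff.1
    ((hf.eventually_eq.and hf.eventually_deriv).and ((hf.eventually_preSchwarzian.and
      hg.eventually_preSchwarzian).and he))
  have hR1 : 0 < |R| + 1 := by positivity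
  -- The last bound makes the linear term win; the others keep the points in the Lipschitz
  -- neighbourhood and in the range of the expansions.
  obtain ⟨ε, ⟨hε1, hεδ, hεR, hεK⟩, hε⟩ : ∃ ε : ℝ,
      (ε < 1 ∧ ε < δ ∧ ε < (|R| + 1)⁻¹ ∧ K * ε ^ 2 < ‖b‖) ∧ 0 < ε := by
    have t : Tendsto (fun ε : ℝ => ε) (𝓝[>] 0) (𝓝 0) := nhdsWithin_le_nhds
    have t2 : Tendsto (fun ε : ℝ => K * ε ^ 2) (𝓝[>] 0) (𝓝 0) := by
      simpa using (t.pow 2).const_mul (K : ℝ)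
    exact ((t.eventually (gt_mem_nhds one_pos)).and ((t.eventually (gt_mem_nhds hδ)).and
      ((t.eventually (gt_mem_nhds (inv_pos.2 hR1))).and
      (t2.eventually (gt_mem_nhds (norm_pos_iff.2 hf.ne_zero)))))).and
      self_mem_nhdsWithin |>.exists
  refine ⟨ε, hε, fun T hT hTε z₁ z₂ hz₁ hz₂ hne h₁ h₂ => ?_⟩
  set s : ℝ := Real.exp (-T) with hs
  have hs0 : 0 < s := Real.exp_pos _
  have hs1 : s ≤ 1 := Real.exp_le_one_iff.2 (by linarith)
  have hsC : (s : ℂ) ≠ 0 := Complex.ofReal_ne_zero.2 hs0.ne'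
  have hεs : ε * s ≤ ε := mul_le_of_le_one_right hε.le hs1
  have hmem : ∀ z : ℂ, ‖z⁻¹‖ < ε * s → ((z⁻¹, 1 - (s : ℂ) ^ 2) : ℂ × ℂ) ∈ Metric.ball (0, 1) δ := by
    intro z hz
    rw [mem_ball_iff_norm]
    simp only [Prod.mk_sub_mk, sub_zero, sub_sub_cancel_left, Prod.norm_mk, norm_neg, norm_pow,
      Complex.norm_real, Real.norm_of_nonneg hs0.le]
    refine max_lt (by linarith) ?_
    nlinarith
  have hsplit : ∀ z : ℂ, z ≠ 0 → ‖z⁻¹‖ < ε * s →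
      (1 - ((s : ℂ) ^ 2 - 1) * z * h z * (α * (preSchwarzian f z - preSchwarzian g z)))
        = expansionDen H α ψ (z⁻¹, 1 - (s : ℂ) ^ 2) ∧
      expansionDen H α ψ (z⁻¹, 1 - (s : ℂ) ^ 2) ≠ 0 ∧
      f z * (1 - ((s : ℂ) ^ 2 - 1) * z * h z * (α * (preSchwarzian f z - preSchwarzian g z)))
          + ((s : ℂ) ^ 2 - 1) * z * h z * deriv f z
        = (b * (s : ℂ) ^ 2 * z + expansionTail H α b φ ψ (z⁻¹, 1 - (s : ℂ) ^ 2))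
          * expansionDen H α ψ (z⁻¹, 1 - (s : ℂ) ^ 2) := by
    intro z hz0 hz
    have hzR : R < ‖z‖ := by
      rw [norm_inv] at hz
      have h3 : ‖z‖⁻¹ < (|R| + 1)⁻¹ := by linarith
      have := (inv_lt_inv₀ (norm_pos_iff.2 hz0) hR1).1 h3
      linarith [le_abs_self R]
    obtain ⟨⟨e1, e2⟩, ⟨e3, e4⟩, e5⟩ := hR z hzR
    have hD := (hball (hmem z hz)).2
    have hχ : H z⁻¹ = 1 + z⁻¹ * dslope H 0 z⁻¹ := by
      have := sub_smul_dslope H 0 z⁻¹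
      rw [hH0, sub_zero, smul_eq_mul] at this
      rw [this]; ring
    have eD : (1 - ((s : ℂ) ^ 2 - 1) * z * h z * (α * (preSchwarzian f z - preSchwarzian g z)))
        = expansionDen H α ψ (z⁻¹, 1 - (s : ℂ) ^ 2) := by
      rw [e3, e4, e5, expansionDen, hψd]
      field_simp
      ring
    refine ⟨eD, hD, ?_⟩
    have hD' : expansionDen H α ψ (z⁻¹, 1 - (s : ℂ) ^ 2) ≠ 0 := hD
    rw [eD, e1, e2, e5, expansionTail]
    -- Here `h f'` equals `b` times the denominator up to a factor `1/z`; thus `b z` and `(s ^ 2 -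
    -- 1) b z` combine to `b s ^ 2 z`, with a regular remainder.
    have hmain : (b - z⁻¹ ^ 2 * deriv φ z⁻¹) * H z⁻¹
        = b * expansionDen H α ψ (z⁻¹, 1 - (s : ℂ) ^ 2)
          + z⁻¹ * (b * dslope H 0 z⁻¹ - z⁻¹ * deriv φ z⁻¹ * H z⁻¹
            - b * α * (1 - (s : ℂ) ^ 2) * H z⁻¹ * z⁻¹ * ψ z⁻¹) := by
      rw [expansionDen]
      linear_combination b * hχ
    have hm2 : ((s : ℂ) ^ 2 - 1) * z * H z⁻¹ * (b - z⁻¹ ^ 2 * deriv φ z⁻¹)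
        = ((s : ℂ) ^ 2 - 1) * (z * b * expansionDen H α ψ (z⁻¹, 1 - (s : ℂ) ^ 2)
          + (b * dslope H 0 z⁻¹ - z⁻¹ * deriv φ z⁻¹ * H z⁻¹
            - b * α * (1 - (s : ℂ) ^ 2) * H z⁻¹ * z⁻¹ * ψ z⁻¹)) := by
      have hzz : z * z⁻¹ = 1 := mul_inv_cancel₀ hz0
      linear_combination ((s : ℂ) ^ 2 - 1) * z * hmain + ((s : ℂ) ^ 2 - 1) *
        (b * dslope H 0 z⁻¹ - z⁻¹ * deriv φ z⁻¹ * H z⁻¹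
            - b * α * (1 - (s : ℂ) ^ 2) * H z⁻¹ * z⁻¹ * ψ z⁻¹) * hzz
    rw [hm2]
    simp only
    generalize expansionDen H α ψ (z⁻¹, 1 - (s : ℂ) ^ 2) = D at hD' ⊢
    generalize b * dslope H 0 z⁻¹ - z⁻¹ * deriv φ z⁻¹ * H z⁻¹
      - b * α * (1 - (s : ℂ) ^ 2) * H z⁻¹ * z⁻¹ * ψ z⁻¹ = M
    field_simp
    ring
  obtain ⟨a1, a2, a3⟩ := hsplit z₁ hz₁ h₁
  obtain ⟨b1, b2, b3⟩ := hsplit z₂ hz₂ h₂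
  rw [a3, b3, a1, b1]
  intro heq
  set G := expansionTail H α b φ ψ with hG
  have heq2 : b * (s : ℂ) ^ 2 * z₁ + G (z₁⁻¹, 1 - (s : ℂ) ^ 2)
      = b * (s : ℂ) ^ 2 * z₂ + G (z₂⁻¹, 1 - (s : ℂ) ^ 2) := by
    refine mul_right_cancel₀ (mul_ne_zero a2 b2) ?_
    linear_combination heq
  have hL := hlip.dist_le_mul _ (hball (hmem z₁ h₁)).1 _ (hball (hmem z₂ h₂)).1
  rw [dist_eq_norm, dist_eq_norm] at hL
  simp only [Prod.mk_sub_mk, sub_self, Prod.norm_mk, norm_zero] at hL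
  rw [max_eq_left (norm_nonneg _)] at hL
  have hGd : G (z₁⁻¹, 1 - (s : ℂ) ^ 2) - G (z₂⁻¹, 1 - (s : ℂ) ^ 2)
      = b * (s : ℂ) ^ 2 * (z₂ - z₁) := by linear_combination heq2
  -- The product `z₁⁻¹ z₂⁻¹` supplies the factor `ε² s²`, matching the `s²` of the linear term.
  have hinv : z₁⁻¹ - z₂⁻¹ = (z₂ - z₁) * (z₁⁻¹ * z₂⁻¹) := by field_simp
  rw [hGd, hinv, norm_mul, norm_mul, norm_mul, norm_mul, norm_pow, Complex.norm_real,
    Real.norm_of_nonneg hs0.le] at hL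
  have hpos : 0 < ‖z₂ - z₁‖ := norm_pos_iff.2 (sub_ne_zero.2 hne.symm)
  have hprod : ‖z₁⁻¹‖ * ‖z₂⁻¹‖ ≤ (ε * s) * (ε * s) :=
    mul_le_mul h₁.le h₂.le (norm_nonneg _) (by positivity)
  have h5 : ‖b‖ * s ^ 2 ≤ K * (ε ^ 2 * s ^ 2) := by
    refine le_of_mul_le_mul_right ?_ hpos
    calc ‖b‖ * s ^ 2 * ‖z₂ - z₁‖ ≤ K * (‖z₂ - z₁‖ * (‖z₁⁻¹‖ * ‖z₂⁻¹‖)) := hL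
      _ ≤ K * (‖z₂ - z₁‖ * ((ε * s) * (ε * s))) := by gcongr
      _ = _ := by ring
  have h6 : ‖b‖ ≤ K * ε ^ 2 := by
    refine le_of_mul_le_mul_right ?_ (pow_pos hs0 2)
    linarith
  linarith

end AsymptoticInjectivity

/-! ### Proof of the criterion. -/

theorem theoremt1 (f g h : ℂ → ℂ) (α : ℂ)
    (hf : ClassSigma f) (hg : ClassSigma g)
    (hfloc : LocallyUnivalentOn f exteriorDisk)
    (hgloc : LocallyUnivalentOn g exteriorDisk)
    (hh : AnalyticOnNhd ℂ h exteriorDisk)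
    (hhre : ∀ ζ ∈ exteriorDisk, 1 / 2 ≤ (h ζ).re)
    (hhexp : ∃ c : ℕ → ℂ, c 0 = 1 ∧ c 1 = 0 ∧
      ∀ ζ ∈ exteriorDisk, HasSum (fun n : ℕ => c n / ζ ^ n) (h ζ))
    (hineq : ∀ ζ ∈ exteriorDisk, AnalyticAt ℂ f ζ → AnalyticAt ℂ g ζ →
      ‖(1 - h ζ) / h ζ * (‖ζ‖ : ℂ) ^ 2
          - ((‖ζ‖ : ℂ) ^ 2 - 1) *
            (ζ * deriv h ζ / h ζ + (1 - 2 * α) * (ζ * deriv (deriv f) ζ / deriv f ζ)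
              + 2 * α * (ζ * deriv (deriv g) ζ / deriv g ζ))
          + α * ((‖ζ‖ : ℂ) ^ 2 - 1) ^ 2 * (ζ / starRingEnd ℂ ζ) * h ζ *
            ((α - 1 / 2) *
                (deriv (deriv f) ζ / deriv f ζ - deriv (deriv g) ζ / deriv g ζ) ^ 2
              + (schwarzian f ζ - schwarzian g ζ))‖ ≤ 1) :
    UnivalentOn f exteriorDisk := by
  refine ⟨hf.1, fun z₁ h₁ z₂ h₂ heq => ?_⟩
  by_contra hne
  have hh0 : ∀ z ∈ exteriorDisk, h z ≠ 0 := fun z hz h0 => by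
    have := hhre z hz
    rw [h0, Complex.zero_re] at this
    norm_num at this
  have hcrit : ∀ z ∈ exteriorDisk, AnalyticAt ℂ f z → AnalyticAt ℂ g z →
      ‖criterionExpr (fun z => (1 - h z) / h z) (riccatiLinear f g h α)
        (riccatiQuadratic f g h α) z‖ ≤ 1 := fun z hz hfz hgz => by
    refine le_trans (le_of_eq ?_) (hineq z hz hfz hgz)
    congr 1
    simp only [criterionExpr, riccatiLinear, riccatiQuadratic, preSchwarzian]
    ring
  obtain ⟨hfa, hga⟩ := analyticOnNhd_of_criterion hfloc hgloc hh hh0 hcrit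
  have hb := analyticOnNhd_riccatiLinear hfloc hgloc hh hh0 hfa hga
  obtain ⟨c, hc, hcq⟩ := exists_riccatiQuadratic_extension hfloc hgloc hh hfa hga
  have hcrit' := norm_criterionExpr_extension_le hfloc hgloc
    ((continuousOn_const.sub hh.continuousOn).div hh.continuousOn hh0) hb.continuousOn
    hc.continuousOn hcq hcrit
  -- behaviour at infinity
  obtain ⟨β, φ, hfe⟩ := hf.exists_hasExpansion
  obtain ⟨β', φ', hge⟩ := hg.exists_hasExpansion
  obtain ⟨H, hH, hH0, hhH⟩ : ∃ H : ℂ → ℂ, AnalyticAt ℂ H 0 ∧ H 0 = 1 ∧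
      ∀ᶠ z in Bornology.cobounded ℂ, h z = H z⁻¹ := by
    obtain ⟨d, hd0, -, hd⟩ := hhexp
    obtain ⟨H, hH, hH0, hhH⟩ := exists_analyticAt_of_hasSum_div_pow (R := 1) hd
    exact ⟨H, hH, hH0.trans hd0, hhH⟩
  have hlimb : Tendsto (fun z => z * riccatiLinear f g h α z) (Bornology.cobounded ℂ) (𝓝 0) := by
    have := (tendsto_mul_deriv_div hH hH0 hhH).add
      ((hfe.tendsto_mul_preSchwarzian.const_mul (1 - 2 * α)).add
        (hge.tendsto_mul_preSchwarzian.const_mul (2 * α)))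
    simp only [mul_zero, add_zero] at this
    refine this.congr fun z => ?_
    rw [riccatiLinear]
    ring
  have hlimh : Tendsto h (Bornology.cobounded ℂ) (𝓝 1) := by
    have := hH.continuousAt.tendsto.comp tendsto_inv_cobounded_nhds
    rw [hH0] at this
    exact this.congr' (hhH.mono fun z hz => hz.symm)
  have hlimc : Tendsto (fun z => z ^ 2 * c z) (Bornology.cobounded ℂ) (𝓝 0) := by
    have := (hlimh.const_mul α).mul (((((hfe.tendsto_mul_preSchwarzian).sub
      hge.tendsto_mul_preSchwarzian).pow 2).const_mul (α - 1 / 2)).add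
      (hfe.tendsto_sq_mul_schwarzian.sub hge.tendsto_sq_mul_schwarzian))
    simp only [sub_self, ne_eq, OfNat.ofNat_ne_zero, not_false_eq_true, zero_pow, mul_zero,
      add_zero] at this
    refine this.congr' ?_
    filter_upwards [hfe.eventually_analyticAt] with z hz
    rw [hcq z hz, riccatiQuadratic]
    ring
  obtain ⟨ε, hε, hsep⟩ := exists_separation (α := α) hfe hge hH hH0 hhH
  obtain ⟨R₁, hR₁⟩ := eventually_cobounded_iff.1 hfe.eventually_analyticAt
  -- flow out to infinity
  obtain ⟨ε', ⟨hε'1, hε'R⟩, hε'0⟩ : ∃ ε' : ℝ, (ε' ≤ ε ∧ ε' * (|R₁| + 1) ≤ 1) ∧ 0 < ε' := by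
    have hp : 0 < |R₁| + 1 := by positivity
    refine ⟨min ε (1 / (|R₁| + 1)), ⟨min_le_left _ _, ?_⟩, lt_min hε (by positivity)⟩
    calc min ε (1 / (|R₁| + 1)) * (|R₁| + 1) ≤ 1 / (|R₁| + 1) * (|R₁| + 1) := by
          gcongr
          exact min_le_right _ _
      _ = 1 := by field_simp
  obtain ⟨T, hT, hTε, Z₁, Z₁', Z₂, Z₂', c₁, c₂, i₁, i₂, hZne, m₁, m₂, s₁, s₂⟩ :=
    exists_riccatiCurves hh.differentiableOn hb.differentiableOn hc.differentiableOn hh0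
      (tendsto_one_sub_div hH hH0 hhH) hlimb hlimc hcrit' h₁ h₂ hne hε'0
  -- representation of `f` as a quotient
  obtain ⟨r, hr1, hr⟩ : ∃ r : ℝ, 1 < r ∧ r < min ‖z₁‖ ‖z₂‖ := exists_between (lt_min h₁ h₂)
  set Ω : Set ℂ := {z | r < ‖z‖} with hΩ
  have hΩU : Ω ⊆ exteriorDisk := fun z hz => hr1.trans hz
  have hΩo : IsOpen Ω := isOpen_lt continuous_const continuous_norm
  obtain ⟨u, v, huv, hcase⟩ : ∃ u v, IsQuotientOn f u v Ω ∧
      (α = 1 / 2 ∨ u = f ∧ v = fun _ => 1) := by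
    by_cases hα : α = 1 / 2
    · obtain ⟨u, v, huv⟩ := exists_isQuotientOn hfloc hR₁ hr1
      exact ⟨u, v, huv, Or.inl hα⟩
    · exact ⟨f, fun _ => 1, isQuotientOn_one ((hfa hα).mono hΩU)
        (fun z hz => hfloc.deriv_ne_zero (hΩU hz) (hfa hα z (hΩU hz))), Or.inr ⟨rfl, rfl⟩⟩
  have hκ : AnalyticOnNhd ℂ (riccatiShift g u v α) Ω := fun z hz =>
    analyticAt_riccatiShift (huv.num z hz) (huv.den z hz) (huv.wronskian_ne z hz) fun hα =>
      ⟨hga hα z (hΩU hz), hgloc.deriv_ne_zero (hΩU hz) (hga hα z (hΩU hz))⟩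
  have hquad : ∀ z ∈ Ω, c z = h z * (deriv (riccatiShift g u v α) z
      + riccatiShift g u v α z ^ 2 - riccatiShift g u v α z * logDeriv (wronskian u v) z
      - wronskianPotential u v z) := by
    intro z hz
    have hzU := hΩU hz
    have a1 := (hc z hzU).continuousAt
    have a2 : ContinuousAt (fun z => h z * (deriv (riccatiShift g u v α) z
      + riccatiShift g u v α z ^ 2 - riccatiShift g u v α z * logDeriv (wronskian u v) z
      - wronskianPotential u v z)) z :=
      (hh z hzU).continuousAt.mul ((((hκ z hz).deriv.continuousAt.add
        ((hκ z hz).continuousAt.pow 2)).sub ((hκ z hz).continuousAt.mul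
        ((huv.num z hz).logDeriv_wronskian (huv.den z hz)
          (huv.wronskian_ne z hz)).continuousAt)).sub
        ((huv.num z hz).wronskianPotential (huv.den z hz) (huv.wronskian_ne z hz)).continuousAt)
    -- The identity is computed off the poles; both sides are continuous at them.
    refine tendsto_nhds_unique_of_eventuallyEq
      (a1.tendsto.mono_left (nhdsWithin_le_nhds (s := {z}ᶜ)))
      (a2.tendsto.mono_left nhdsWithin_le_nhds) ?_
    filter_upwards [hfloc.eventually_analyticAt hzU, hgloc.eventually_analyticAt hzU,
      nhdsWithin_le_nhds (hΩo.mem_nhds hz)] with w hfw hgw hw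
    obtain ⟨e1, e2⟩ := huv.eq_mul w hw hfw
    rw [hcq w hfw]
    exact riccatiQuadratic_eq hcase hfw (hfloc.deriv_ne_zero (hΩU hw) hfw) hgw
      (hgloc.deriv_ne_zero (hΩU hw) hgw) (huv.den w hw) e1 e2
  have hΩ₁ : ∀ t ∈ Icc 0 T, Z₁ t ∈ Ω := fun t ht =>
    (hr.trans_le (min_le_left _ _)).trans_le (by simpa [i₁] using c₁.norm_le t ht)
  have hΩ₂ : ∀ t ∈ Icc 0 T, Z₂ t ∈ Ω := fun t ht =>
    (hr.trans_le (min_le_right _ _)).trans_le (by simpa [i₂] using c₂.norm_le t ht)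
  have hz₁ : z₁ ∈ Ω := hr.trans_le (min_le_left _ _)
  have hz₂ : z₂ ∈ Ω := hr.trans_le (min_le_right _ _)
  have hinit : u z₁ * v z₂ = u z₂ * v z₁ := by
    by_cases p₁ : AnalyticAt ℂ f z₁ <;> by_cases p₂ : AnalyticAt ℂ f z₂
    · rw [sphereValue_of_analyticAt p₁, sphereValue_of_analyticAt p₂, OnePoint.coe_eq_coe] at heq
      rw [(huv.eq_mul _ hz₁ p₁).2.self_of_nhds, (huv.eq_mul _ hz₂ p₂).2.self_of_nhds]
      simp only [heq]
      ring
    · rw [sphereValue_of_analyticAt p₁, sphereValue_of_not_analyticAt (hf.1 h₂) p₂] at heq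
      exact absurd heq (OnePoint.coe_ne_infty _)
    · rw [sphereValue_of_not_analyticAt (hf.1 h₁) p₁, sphereValue_of_analyticAt p₂] at heq
      exact absurd heq.symm (OnePoint.coe_ne_infty _)
    · rw [(huv.pole _ hz₁ p₁).1, (huv.pole _ hz₂ p₂).1, mul_zero, mul_zero]
  have hcross := riccatiLift_cross_eq (L := logDeriv (wronskian u v))
    (ν := wronskianPotential u v) hT c₁ c₂ hΩ₁ hΩ₂ (hh.mono hΩU) hκ (hc.mono hΩU) huv.num huv.den
    (fun z hz => hh0 z (hΩU hz)) (fun z _ => riccatiLinear_eq hcase) hquad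
    (fun z hz => deriv_deriv_num (huv.num z hz) (huv.den z hz) (huv.wronskian_ne z hz))
    (fun z hz => deriv_deriv_den (huv.num z hz) (huv.den z hz) (huv.wronskian_ne z hz))
    (by rw [i₁, i₂]; exact hinit)
  have hTm : T ∈ Icc 0 T := right_mem_Icc.2 hT
  have hexp1 : Real.exp (-T) ≤ 1 := Real.exp_le_one_iff.2 (by linarith)
  have hfar : ∀ z ∈ exteriorDisk, ‖z⁻¹‖ < ε' * Real.exp (-T) → AnalyticAt ℂ f z := by
    intro z hz hzs
    refine hR₁ z ?_
    have h3 : ‖z‖⁻¹ < ε' := by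
      rw [← norm_inv]; exact hzs.trans_le (mul_le_of_le_one_right hε'0.le hexp1)
    have h4 : 0 < ‖z‖ := zero_lt_one.trans hz
    have h5 : 1 < ε' * ‖z‖ := by
      rwa [inv_lt_iff_one_lt_mul₀ h4] at h3
    have h6 : |R₁| + 1 ≤ ‖z‖ := by
      by_contra hlt
      have := mul_lt_mul_of_pos_left (not_le.1 hlt) hε'0
      linarith
    linarith [le_abs_self R₁]
  have f₁ := hfar _ m₁ s₁
  have f₂ := hfar _ m₂ s₂
  obtain ⟨v₁, w₁⟩ := huv.eq_mul _ (hΩ₁ T hTm) f₁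
  obtain ⟨v₂, w₂⟩ := huv.eq_mul _ (hΩ₂ T hTm) f₂
  have d₁ := hfloc.deriv_ne_zero m₁ f₁
  have d₂ := hfloc.deriv_ne_zero m₂ f₂
  have n₁ := huv.den _ (hΩ₁ T hTm)
  have n₂ := huv.den _ (hΩ₂ T hTm)
  rw [riccatiLift_num hcase f₁ d₁ n₁ v₁ w₁, riccatiLift_num hcase f₂ d₂ n₂ v₂ w₂,
    riccatiLift_den hcase f₁ d₁ n₁ v₁ w₁, riccatiLift_den hcase f₂ d₂ n₂ v₂ w₂] at hcross
  have hle : ε' * Real.exp (-T) ≤ ε * Real.exp (-T) := by gcongr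
  refine hsep T hT (hTε.trans_le hε'1) (Z₁ T) (Z₂ T) (ne_zero_of_mem_exteriorDisk m₁)
    (ne_zero_of_mem_exteriorDisk m₂) hZne (s₁.trans_le hle) (s₂.trans_le hle) ?_
  -- Both endpoints are regular points of `f`, so the factors `v` do not vanish there and can be
  -- cancelled.
  refine mul_left_cancel₀ (mul_ne_zero v₁ v₂) ?_
  linear_combination hcross
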